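/- **Setting.** Let $m\ge 1$, $0=b_0<b_1<\dots<b_m=a$, let $\gamma_1,\dots,\gamma_m>0$, and let $\gamma(x)=\gamma_j$ for $b_{j-1}<x<b_j$. Let $\rho\ge 0$ and $T>0$. Let $u$ be a (real- or complex-valued) solution of $$u_t=(\gamma u_x)_x \text{ in } ]0,a[\times]0,T[,\qquad \gamma_m u_x(a,t)+\rho\,u(a,t)=0 \ (0<t<T),\qquad u(x,0)=0 \ (0<x<a),$$ in the variational sense and with $u_x(0,\cdot)\in L^2(0,T)$; that is, $u\in L^2(0,T;H^1(]0,a[))$ and, for every $\varphi\in H^1(]0,a[)$, $$\frac{d}{dt}\int_0^a u\varphi\,dx+\int_0^a\gamma u_x\varphi'\,dx+\rho\,u(a,t)\varphi(a)+\gamma_1u_x(0,t)\varphi(0)=0$$ in the sense of distributions on $]0,T[$, with $u(\cdot,0)=0$ (so that $u_t\in L^2(0,T;H^1(]0,a[)')$). For $c>0$ and $\tau>c^{-2}$ put $z=-c\tau\left(1+i\sqrt{1-\frac1{c^2\tau}}\right)$ and $z_j=z/\sqrt{\gamma_j}$. Let $\Psi=\Psi_\tau$ be the function on $\mathbb R$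 with $$\Psi(x)=A_je^{xz_j}+B_je^{-xz_j}\quad\text{in the } j\text{-th layer},\qquad A_1=1,\quad B_m=0,$$ where the first layer is extended to $-\infty$ and the last one to $+\infty$, which solves $(\tilde\gamma\Psi')'-z^2\Psi=0$ in $\mathbb R$, where $\tilde\gamma$ is the correspondingly extended conductivity; that is, $\Psi$ and $\tilde\gamma\Psi'$ are continuous across $b_1,\dots,b_{m-1}$. Put $v(x,t)=e^{-z^2t}\Psi_\tau(x)$ and $$I_c(\tau)=\int_0^T\bigl(-\gamma_1v_x(0,t)u(0,t)+\gamma_1u_x(0,t)v(0,t)\bigr)\,dt .$$ **Theorem 2.3.** Let $$\ell=\frac{b_1}{\sqrt{\gamma_1}}+\sum_{j=1}^{m-1}\frac{b_{j+1}-b_j}{\sqrt{\gamma_{j+1}}},$$ let $M>0$ satisfy $M\ge 2\ell$, and let $c>0$ satisfy $Mc<T$. Assume that there are $C>0$, $\tau_0>c^{-2}$ and $\mu\in\mathbb R$ such that for all $\tau>\tau_0$ $$C\tau^\mu\le\left|\int_0^Te^{-z^2t}u_x(0,t)\,dt\right|.\tag{2.7}$$ Then, for all sufficiently large $\tau$,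 the coefficients of $\Psi_\tau$ exist and are unique, so that $I_c(\tau)$ is well defined, and $$\lim_{\tau\to\infty}\frac{\log|I_c(\tau)|}{\tau}=-2c\left(\frac{b_1}{\sqrt{\gamma_1}}+\sum_{j=1}^{m-1}\frac{b_{j+1}-b_j}{\sqrt{\gamma_{j+1}}}\right).$$ -/

import Mathlib

open MeasureTheory Set Filter Topology
open scoped ContDiff

namespace LayeredHeat

/-- The number `z = -cτ (1 + i √(1 - 1/(c²τ)))`, used for `τ > c⁻²`. -/
noncomputable def zc (c τ : ℝ) : ℂ :=
  -((c : ℂ) * (τ : ℂ)) * (1 + Complex.I * (Real.sqrt (1 - 1 / (c ^ 2 * τ)) : ℂ))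

/-! The interfaces are `0 = b 0 < b 1 < ⋯ < b m = a`; the `j`-th layer (`1 ≤ j ≤ m`) is
`]b (j-1), b j[` and has conductivity `γ j`.  Other values of `b` and `γ` are irrelevant. -/

/-- Index in `{1, …, m}` of the layer containing `x`; the first layer is extended to `-∞` and the
last one to `+∞`.  (At an interface the layer on the right is taken.) -/
noncomputable def layerIndex (m : ℕ) (b : ℕ → ℝ) (x : ℝ) : ℕ :=
  1 + ((Finset.Ico 1 m).filter (fun j => b j ≤ x)).card

/-- The piecewise constant conductivity, extended to the whole line. -/
noncomputable def conductivity (m : ℕ) (γ b : ℕ → ℝ) (x : ℝ) : ℝ :=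
  γ (layerIndex m b x)

/-- Travel time `b_1/√γ_1 + ∑_{j=1}^{m-1} (b_{j+1} - b_j)/√γ_{j+1}` through all the layers. -/
noncomputable def travelTime (m : ℕ) (γ b : ℕ → ℝ) : ℝ :=
  b 1 / Real.sqrt (γ 1) +
    ∑ j ∈ Finset.Ico 1 m, (b (j + 1) - b j) / Real.sqrt (γ (j + 1))

/-! ### Weak solutions of the initial boundary value problem -/

/-- `φ` belongs to `H¹(]0,a[)`, with weak derivative `φ'`; `φ` is the representative that is
absolutely continuous on `[0,a]`, so that `φ 0` and `φ a` are the traces of `φ`. -/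
def IsH1 (a : ℝ) (φ φ' : ℝ → ℂ) : Prop :=
  MemLp φ' 2 (volume.restrict (Ioo 0 a)) ∧
    ∀ x ∈ Icc 0 a, φ x = φ 0 + ∫ ξ in (0 : ℝ)..x, φ' ξ

/-- `u = u(x,t)` belongs to `L²(0,T; H¹(]0,a[))`, with weak derivative `ux` in `x`; for almost
every `t`, `u(·,t)` is the absolutely continuous representative. -/
structure MemL2H1 (a T : ℝ) (u ux : ℝ → ℝ → ℂ) : Prop where
  memLp : MemLp (fun p : ℝ × ℝ => u p.1 p.2) 2 (volume.restrict (Ioo 0 a ×ˢ Ioo 0 T))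
  memLp_deriv : MemLp (fun p : ℝ × ℝ => ux p.1 p.2) 2 (volume.restrict (Ioo 0 a ×ˢ Ioo 0 T))
  isH1 : ∀ᵐ t ∂(volume.restrict (Ioo 0 T)), IsH1 a (fun x => u x t) (fun x => ux x t)

/-- `u` is a variational solution of
`u_t = (γ u_x)_x` in `]0,a[ × ]0,T[`, `γ_m u_x(a,t) + ρ u(a,t) = 0`, `u(x,0) = 0`
(with `a = b m`), whose Neumann boundary value `u_x(0,·)` is `g ∈ L²(0,T)`:
for every `φ ∈ H¹(]0,a[)`,
`d/dt ∫ u(·,t) φ + ∫ γ u_x(·,t) φ' + ρ u(a,t) φ(a) + γ_1 g(t) φ(0) = 0`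
in the sense of distributions in `t`.  The test functions `θ` vanish near `t = T` but need not
vanish at `t = 0`, which expresses the initial condition.  That `u_t` is in
`L²(0,T; H¹(]0,a[)')`, i.e. `u ∈ W(0,T; H¹, (H¹)')`, is contained in this identity, since all its
other terms are pairings of `φ` with elements of `L²(0,T; H¹(]0,a[)')`. -/
structure IsHeatSolution (m : ℕ) (γ b : ℕ → ℝ) (ρ T : ℝ) (u : ℝ → ℝ → ℂ) (g : ℝ → ℂ) :
    Prop where
  flux_memLp : MemLp g 2 (volume.restrict (Ioo 0 T))
  weak : ∃ ux : ℝ → ℝ → ℂ, MemL2H1 (b m) T u ux ∧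
    ∀ φ φ' : ℝ → ℂ, IsH1 (b m) φ φ' →
    ∀ θ : ℝ → ℝ, ContDiff ℝ ∞ θ → (∃ s < T, ∀ t, s ≤ t → θ t = 0) →
      -(∫ t in (0 : ℝ)..T, (∫ x in (0 : ℝ)..(b m), u x t * φ x) * ((deriv θ t : ℝ) : ℂ))
      + (∫ t in (0 : ℝ)..T,
          (∫ x in (0 : ℝ)..(b m), (conductivity m γ b x : ℂ) * ux x t * φ' x) * (θ t : ℂ))
      + (ρ : ℂ) * (∫ t in (0 : ℝ)..T, u (b m) t * φ (b m) * (θ t : ℂ))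
      + (γ 1 : ℂ) * (∫ t in (0 : ℝ)..T, g t * φ 0 * (θ t : ℂ)) = 0

/-! ### The special solution and the indicator function -/

/-- `A e^{x z/√κ} + B e^{-x z/√κ}`, the general solution of `κ y'' - z² y = 0`. -/
noncomputable def layerWave (κ : ℝ) (z A B : ℂ) (x : ℝ) : ℂ :=
  A * Complex.exp ((x : ℂ) * (z / (Real.sqrt κ : ℂ))) +
    B * Complex.exp (-((x : ℂ) * (z / (Real.sqrt κ : ℂ))))

/-- The coefficients `A_1 = 1, B_1, A_2, B_2, …, A_m, B_m = 0` are such that the function equal to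
`A_j e^{x z_j} + B_j e^{-x z_j}` in the `j`-th layer, `z_j = z/√γ_j`, solves
`(γ Ψ')' - z² Ψ = 0` on the whole line: `Ψ` and the flux `γ Ψ'` are continuous across each
interface `b_1, …, b_{m-1}`.  (Coefficients with other indices are `0`, by convention.) -/
structure IsLayerCoeff (m : ℕ) (γ b : ℕ → ℝ) (z : ℂ) (A B : ℕ → ℂ) : Prop where
  first : A 1 = 1
  last : B m = 0
  continuity : ∀ j ∈ Finset.Ico 1 m,
    layerWave (γ j) z (A j) (B j) (b j) =
      layerWave (γ (j + 1)) z (A (j + 1)) (B (j + 1)) (b j)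
  flux : ∀ j ∈ Finset.Ico 1 m,
    (γ j : ℂ) * deriv (layerWave (γ j) z (A j) (B j)) (b j) =
      (γ (j + 1) : ℂ) * deriv (layerWave (γ (j + 1)) z (A (j + 1)) (B (j + 1))) (b j)
  outside : ∀ j, j ∉ Finset.Icc 1 m → A j = 0 ∧ B j = 0

/-- The coefficients `(A, B)` of the special solution (meaningful when they exist). -/
noncomputable def layerCoeff (m : ℕ) (γ b : ℕ → ℝ) (z : ℂ) : (ℕ → ℂ) × (ℕ → ℂ) :=
  Classical.epsilon (fun p : (ℕ → ℂ) × (ℕ → ℂ) => IsLayerCoeff m γ b z p.1 p.2)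

/-- The special solution `Ψ` of `(γ Ψ')' - z² Ψ = 0` on the line. -/
noncomputable def Psi (m : ℕ) (γ b : ℕ → ℝ) (z : ℂ) (x : ℝ) : ℂ :=
  layerWave (conductivity m γ b x) z
    ((layerCoeff m γ b z).1 (layerIndex m b x)) ((layerCoeff m γ b z).2 (layerIndex m b x)) x

/-- The solution `v(x,t) = e^{-z² t} Ψ(x)` of the backward heat equation. -/
noncomputable def backwardHeat (m : ℕ) (γ b : ℕ → ℝ) (z : ℂ) (x t : ℝ) : ℂ :=
  Complex.exp (-z ^ 2 * (t : ℂ)) * Psi m γ b z x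

/-- The indicator function
`I_c(τ) = ∫_0^T (-γ_1 v_x(0,t) u(0,t) + γ_1 u_x(0,t) v(0,t)) dt`, where `u_x(0,t) = g t`. -/
noncomputable def indicatorFn (m : ℕ) (γ b : ℕ → ℝ) (T : ℝ) (u : ℝ → ℝ → ℂ) (g : ℝ → ℂ)
    (c τ : ℝ) : ℂ :=
  ∫ t in (0 : ℝ)..T,
    (-((γ 1 : ℂ) * deriv (fun x : ℝ => backwardHeat m γ b (zc c τ) x t) 0 * u 0 t)
      + (γ 1 : ℂ) * g t * backwardHeat m γ b (zc c τ) 0 t)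

end LayeredHeat

/-! Write X = e^{zℓ}, where ℓ is the travel time. Since Re z = -cτ and Re(-z²) = -τ, one has |X²| =
e^{-2cℓτ}, while the weight e^{-z²t} has modulus e^{-τt}. The claim amounts to I_c(τ) = k X² G + O(τ
e^{-στ}), where G is the integral in the flux hypothesis, k tends to a nonzero constant and 2cℓ < σ
< T. As G lies between Cτ^μ and a constant, taking logarithms gives the limit
(`tendsto_log_norm_div_of_isBigO`).

The unknown trace u(0,·) is eliminated by duality. Besides Ψ, take a second stationary wave Φ, the
one that satisfies the Robin condition at b_m, and test the weak formulation with Φ(x) e^{-z²t}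
χ(t), where χ is a cutoff equal to 1 up to time σ. The boundary term at b_m drops out, and the
transform of u(0,·) becomes a multiple of that of the flux, up to errors living in t ≥ σ
(`IsHeatSolution.test_gluedWave`).

Substituting this in I_c leaves in front of G the Wronskian of Ψ and Φ at 0, divided by the flux of
Φ (`indicator_sub_main_eq`). The Wronskian is the same in every layer (`IsMatched.wronskian_eq`), so
it can be read off at b_m, where Ψ is purely outgoing.

The size of the waves at 0 comes from a recursion over the layers with amplitudes rescaled by the
travel time. Reflected contributions carry a factor e^{2zs}, s > 0, and vanish in the limit, whereas
the leading amplitude is multiplied at each interface by a positive number (`exists_tendsto_norm`).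
This also shows that Ψ exists for large τ; its uniqueness is again the Wronskian identity. -/

namespace LayeredHeat

/-! ### Integration by parts for complex primitives -/

/-- Fubini on the triangle ξ ≤ x, for the integrand p(x) q(ξ). -/
theorem integral_mul_primitive_swap {a : ℝ} (ha : 0 ≤ a) {p q : ℝ → ℂ}
    (hp : IntervalIntegrable p volume 0 a) (hq : IntervalIntegrable q volume 0 a) :
    ∫ x in (0 : ℝ)..a, p x * ∫ ξ in (0 : ℝ)..x, q ξ =
      ∫ ξ in (0 : ℝ)..a, (∫ x in ξ..a, p x) * q ξ := by
  rw [intervalIntegrable_iff_integrableOn_Ioc_of_le ha] at hp hq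
  have hint : Integrable (Function.uncurry fun x ξ : ℝ =>
      ({r : ℝ × ℝ | r.2 ≤ r.1}.indicator (fun r => p r.1 * q r.2)) (x, ξ))
      ((volume.restrict (Ioc 0 a)).prod (volume.restrict (Ioc 0 a))) := by
    have := (Integrable.mul_prod (μ := volume.restrict (Ioc 0 a))
      (ν := volume.restrict (Ioc 0 a)) hp hq).indicator
      (measurableSet_le measurable_snd measurable_fst : MeasurableSet {r : ℝ × ℝ | r.2 ≤ r.1})
    exact this
  have key := integral_integral_swap hint
  rw [intervalIntegral.integral_of_le ha, intervalIntegral.integral_of_le ha]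
  convert key using 1
  · refine setIntegral_congr_fun measurableSet_Ioc fun x hx => ?_
    have : ∀ ξ, ({r : ℝ × ℝ | r.2 ≤ r.1}.indicator (fun r => p r.1 * q r.2)) (x, ξ) =
        (Iic x).indicator (fun ξ => p x * q ξ) ξ := fun ξ => by
      by_cases h : ξ ≤ x <;> simp [indicator, h]
    simp only [this]
    rw [setIntegral_indicator measurableSet_Iic, integral_const_mul, Ioc_inter_Iic,
      min_eq_right hx.2, intervalIntegral.integral_of_le hx.1.le]
  · refine setIntegral_congr_fun measurableSet_Ioc fun ξ hξ => ?_
    have : ∀ x, ({r : ℝ × ℝ | r.2 ≤ r.1}.indicator (fun r => p r.1 * q r.2)) (x, ξ) =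
        (Ici ξ).indicator (fun x => p x * q ξ) x := fun x => by
      by_cases h : ξ ≤ x <;> simp [indicator, h]
    simp only [this]
    have hs : Ioc 0 a ∩ Ici ξ = Icc ξ a := by
      ext x
      simp only [mem_inter_iff, mem_Ioc, mem_Ici, mem_Icc]
      exact ⟨fun h => ⟨h.2, h.1.2⟩, fun h => ⟨⟨hξ.1.trans_le h.1, h.2⟩, h.1⟩⟩
    rw [setIntegral_indicator measurableSet_Ici, hs, integral_mul_const,
      integral_Icc_eq_integral_Ioc, intervalIntegral.integral_of_le hξ.2]

theorem continuousOn_of_primitive {a : ℝ} (ha : 0 ≤ a) {p P : ℝ → ℂ}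
    (hp : IntervalIntegrable p volume 0 a)
    (hP : ∀ x ∈ Icc 0 a, P x = P 0 + ∫ ξ in (0 : ℝ)..x, p ξ) : ContinuousOn P (Icc 0 a) := by
  have h := intervalIntegral.continuousOn_primitive_interval (a := 0) (b := a) (μ := volume)
    (f := p) (by rwa [uIcc_of_le ha, integrableOn_Icc_iff_integrableOn_Ioc,
      ← intervalIntegrable_iff_integrableOn_Ioc_of_le ha])
  rw [uIcc_of_le ha] at h
  exact (continuousOn_const.add h).congr hP

/-- Integration by parts for absolutely continuous functions: the derivatives are merely integrable.
Writing P as P(a) minus an integral over [x, a] and Q as Q(0) plus an integral over [0, x], the two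
double integrals cancel by the triangle swap. -/
theorem integral_mul_deriv_add_deriv_mul_of_primitive {a : ℝ} (ha : 0 ≤ a) {p q P Q : ℝ → ℂ}
    (hp : IntervalIntegrable p volume 0 a) (hq : IntervalIntegrable q volume 0 a)
    (hP : ∀ x ∈ Icc 0 a, P x = P 0 + ∫ ξ in (0 : ℝ)..x, p ξ)
    (hQ : ∀ x ∈ Icc 0 a, Q x = Q 0 + ∫ ξ in (0 : ℝ)..x, q ξ) :
    (∫ x in (0 : ℝ)..a, P x * q x) + ∫ x in (0 : ℝ)..a, p x * Q x = P a * Q a - P 0 * Q 0 := by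
  have hsub : ∀ x ∈ uIcc 0 a, uIcc 0 x ⊆ uIcc 0 a := fun x hx => uIcc_subset_uIcc_left hx
  have hpx : ∀ x ∈ uIcc 0 a, IntervalIntegrable p volume 0 x := fun x hx => hp.mono_set (hsub x hx)
  have hI : ∀ x ∈ uIcc 0 a, P x = P a - ∫ ξ in x..a, p ξ := by
    intro x hx
    have hx' := hx
    rw [uIcc_of_le ha] at hx'
    rw [hP x hx', hP a ⟨ha, le_rfl⟩, ← intervalIntegral.integral_interval_sub_left hp (hpx x hx)]
    ring
  have hcP := continuousOn_of_primitive ha hp hP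
  have hcQ := continuousOn_of_primitive ha hq hQ
  rw [← uIcc_of_le ha] at hcP hcQ
  have h1 : ∫ x in (0 : ℝ)..a, p x * Q x =
      Q 0 * (∫ x in (0 : ℝ)..a, p x) + ∫ x in (0 : ℝ)..a, p x * ∫ ξ in (0 : ℝ)..x, q ξ := by
    rw [← intervalIntegral.integral_const_mul, ← intervalIntegral.integral_add]
    · refine intervalIntegral.integral_congr fun x hx => ?_
      rw [uIcc_of_le ha] at hx
      simp only [hQ x hx]
      ring
    · exact hp.const_mul _
    · refine hp.mul_continuousOn ((hcQ.sub (continuousOn_const (c := Q 0))).congr fun x hx => ?_)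
      rw [uIcc_of_le ha] at hx
      simp [hQ x hx]
  have h2 : ∫ x in (0 : ℝ)..a, P x * q x =
      P a * (∫ x in (0 : ℝ)..a, q x) - ∫ ξ in (0 : ℝ)..a, (∫ x in ξ..a, p x) * q ξ := by
    rw [← intervalIntegral.integral_const_mul, ← intervalIntegral.integral_sub]
    · refine intervalIntegral.integral_congr fun x hx => ?_
      simp only [hI x hx]
      ring
    · exact hq.const_mul _
    · refine hq.continuousOn_mul ((continuousOn_const (c := P a)).sub hcP |>.congr fun x hx => ?_)
      simp [hI x hx]
  rw [h1, h2, integral_mul_primitive_swap ha hp hq, hP a ⟨ha, le_rfl⟩, hQ a ⟨ha, le_rfl⟩]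
  ring

end LayeredHeat

namespace LayeredHeat

/-! ### Functions defined layer by layer -/

section Layers

variable {m : ℕ} {b : ℕ → ℝ}

theorem le_of_forall_lt_succ (hb : ∀ j < m, b j < b (j + 1)) {i j : ℕ} (hij : i ≤ j)
    (hj : j ≤ m) : b i ≤ b j := by
  induction j, hij using Nat.le_induction with
  | base => exact le_rfl
  | succ k hk ih => exact (ih (by omega)).trans (hb k (by omega)).le

theorem layerIndex_mem (hm : 1 ≤ m) (x : ℝ) : layerIndex m b x ∈ Finset.Icc 1 m := by
  have h := Finset.card_filter_le (Finset.Ico 1 m) (fun j => b j ≤ x)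
  rw [Nat.card_Ico] at h
  rw [Finset.mem_Icc, layerIndex]
  omega

/-- The interfaces increase, so those at most x form an initial segment, and counting them locates
x. -/
theorem lt_layerIndex_iff (hb : ∀ j < m, b j < b (j + 1)) {j : ℕ} (hj : j ∈ Finset.Ico 1 m)
    (x : ℝ) : j < layerIndex m b x ↔ b j ≤ x := by
  rw [Finset.mem_Ico] at hj
  constructor
  · intro h
    by_contra hx
    have hsub : (Finset.Ico 1 m).filter (fun i => b i ≤ x) ⊆ Finset.Ico 1 j := by
      intro i hi
      rw [Finset.mem_filter, Finset.mem_Ico] at hi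
      rw [Finset.mem_Ico]
      refine ⟨hi.1.1, lt_of_not_ge fun hji => hx ?_⟩
      exact (le_of_forall_lt_succ hb hji hi.1.2.le).trans hi.2
    have := Finset.card_le_card hsub
    rw [Nat.card_Ico] at this
    rw [layerIndex] at h
    omega
  · intro h
    have hsub : Finset.Icc 1 j ⊆ (Finset.Ico 1 m).filter (fun i => b i ≤ x) := by
      intro i hi
      rw [Finset.mem_Icc] at hi
      rw [Finset.mem_filter, Finset.mem_Ico]
      exact ⟨⟨hi.1, by omega⟩, (le_of_forall_lt_succ hb hi.2 hj.2.le).trans h⟩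
    have := Finset.card_le_card hsub
    rw [Nat.card_Icc] at this
    rw [layerIndex]
    omega

/-- Telescoping over the interfaces to the left of x. It reduces measurability and continuity of
layerwise functions to single `if` terms. -/
theorem apply_layerIndex {G : Type*} [AddCommGroup G] (hb : ∀ j < m, b j < b (j + 1))
    (hm : 1 ≤ m) (F : ℕ → G) (x : ℝ) :
    F (layerIndex m b x) =
      F 1 + ∑ j ∈ Finset.Ico 1 m, if b j ≤ x then F (j + 1) - F j else 0 := by
  have hi := Finset.mem_Icc.1 (layerIndex_mem (b := b) hm x)
  have hfil : (Finset.Ico 1 m).filter (fun j => b j ≤ x) = Finset.Ico 1 (layerIndex m b x) := by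
    ext j
    rw [Finset.mem_filter]
    constructor
    · rintro ⟨h1, h2⟩
      exact Finset.mem_Ico.2 ⟨(Finset.mem_Ico.1 h1).1, (lt_layerIndex_iff hb h1 x).2 h2⟩
    · intro h
      have h' := Finset.mem_Ico.1 h
      have h1 : j ∈ Finset.Ico 1 m := Finset.mem_Ico.2 ⟨h'.1, by omega⟩
      exact ⟨h1, (lt_layerIndex_iff hb h1 x).1 h'.2⟩
  rw [← Finset.sum_filter, hfil, Finset.sum_Ico_sub F hi.1]
  abel

theorem layerIndex_eq_one (hb : ∀ j < m, b j < b (j + 1)) (hm : 1 ≤ m) {x : ℝ} (hx : x < b 1) :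
    layerIndex m b x = 1 := by
  have hi := Finset.mem_Icc.1 (layerIndex_mem (b := b) hm x)
  by_contra h
  exact absurd ((lt_layerIndex_iff hb (Finset.mem_Ico.2 ⟨le_rfl, by omega⟩) x).1 (by omega))
    (not_le.2 hx)

theorem layerIndex_eq_last (hb : ∀ j < m, b j < b (j + 1)) (hm : 1 ≤ m) :
    layerIndex m b (b m) = m := by
  have hi := Finset.mem_Icc.1 (layerIndex_mem (b := b) hm (b m))
  by_contra h
  have := (lt_layerIndex_iff hb (Finset.mem_Ico.2 ⟨hi.1, by omega⟩) (b m)).2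
    (le_of_forall_lt_succ hb hi.2 le_rfl)
  omega

theorem mem_Icc_layerIndex (hb : ∀ j < m, b j < b (j + 1)) (hm : 1 ≤ m) {x : ℝ}
    (hx : x ∈ Icc (b 0) (b m)) :
    x ∈ Icc (b (layerIndex m b x - 1)) (b (layerIndex m b x)) := by
  have hi := Finset.mem_Icc.1 (layerIndex_mem (b := b) hm x)
  constructor
  · rcases eq_or_lt_of_le hi.1 with h | h
    · rw [← h]; exact hx.1
    · exact (lt_layerIndex_iff hb (Finset.mem_Ico.2 ⟨by omega, by omega⟩) x).1 (by omega)
  · rcases eq_or_lt_of_le hi.2 with h | h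
    · rw [h]; exact hx.2
    · exact (not_le.1 fun hle => lt_irrefl _
        ((lt_layerIndex_iff hb (Finset.mem_Ico.2 ⟨hi.1, h⟩) x).2 hle)).le

theorem measurable_apply_layerIndex {G : Type*} [AddCommGroup G] [MeasurableSpace G]
    [MeasurableAdd₂ G] [MeasurableSub₂ G] (hb : ∀ j < m, b j < b (j + 1)) (hm : 1 ≤ m)
    {F : ℕ → ℝ → G} (hF : ∀ j ∈ Finset.Icc 1 m, Measurable (F j)) :
    Measurable fun x => F (layerIndex m b x) x := by
  have : (fun x => F (layerIndex m b x) x) = fun x => F 1 x +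
      ∑ j ∈ Finset.Ico 1 m, if b j ≤ x then F (j + 1) x - F j x else 0 := by
    funext x
    exact apply_layerIndex hb hm (fun j => F j x) x
  rw [this]
  refine (hF 1 (Finset.mem_Icc.2 ⟨le_rfl, hm⟩)).add (Finset.measurable_fun_sum _ fun j hj => ?_)
  have hj' := Finset.mem_Ico.1 hj
  exact Measurable.ite measurableSet_Ici
    ((hF (j + 1) (Finset.mem_Icc.2 ⟨by omega, hj'.2⟩)).sub
      (hF j (Finset.mem_Icc.2 ⟨hj'.1, hj'.2.le⟩))) measurable_const

/-- Each jump term switches on at b_j, exactly where F (j+1) - F j vanishes. -/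
theorem continuous_apply_layerIndex {G : Type*} [AddCommGroup G] [TopologicalSpace G]
    [IsTopologicalAddGroup G] (hb : ∀ j < m, b j < b (j + 1)) (hm : 1 ≤ m)
    {F : ℕ → ℝ → G} (hF : ∀ j ∈ Finset.Icc 1 m, Continuous (F j))
    (hmatch : ∀ j ∈ Finset.Ico 1 m, F j (b j) = F (j + 1) (b j)) :
    Continuous fun x => F (layerIndex m b x) x := by
  have : (fun x => F (layerIndex m b x) x) = fun x => F 1 x +
      ∑ j ∈ Finset.Ico 1 m, if b j ≤ x then F (j + 1) x - F j x else 0 := by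
    funext x
    exact apply_layerIndex hb hm (fun j => F j x) x
  rw [this]
  refine (hF 1 (Finset.mem_Icc.2 ⟨le_rfl, hm⟩)).add (continuous_finsetSum _ fun j hj => ?_)
  have hj' := Finset.mem_Ico.1 hj
  refine Continuous.if_le ((hF (j + 1) (Finset.mem_Icc.2 ⟨by omega, hj'.2⟩)).sub
    (hF j (Finset.mem_Icc.2 ⟨hj'.1, hj'.2.le⟩))) continuous_const continuous_const
    continuous_id fun x hx => ?_
  rw [← hx, hmatch j hj, sub_self]

theorem hasDerivAt_apply_layerIndex {F F' : ℕ → ℝ → ℂ} {x : ℝ} (hm : 1 ≤ m)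
    (hF : ∀ j ∈ Finset.Icc 1 m, HasDerivAt (F j) (F' j x) x) (hx : x ∉ range b) :
    HasDerivAt (fun x => F (layerIndex m b x) x) (F' (layerIndex m b x) x) x := by
  have hev : ∀ᶠ y in 𝓝 x, layerIndex m b y = layerIndex m b x := by
    have : ∀ᶠ y in 𝓝 x, ∀ j ∈ Finset.Ico 1 m, (b j ≤ y ↔ b j ≤ x) := by
      rw [Filter.eventually_all_finset]
      intro j _
      rcases lt_or_gt_of_ne (fun h => hx ⟨j, h⟩ : b j ≠ x) with h | h
      · filter_upwards [lt_mem_nhds h] with y hy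
        exact ⟨fun _ => h.le, fun _ => hy.le⟩
      · filter_upwards [gt_mem_nhds h] with y hy
        exact ⟨fun h' => absurd h' (not_le.2 hy), fun h' => absurd h' (not_le.2 h)⟩
    filter_upwards [this] with y hy
    rw [layerIndex, layerIndex, Finset.filter_congr hy]
  refine (hF _ (layerIndex_mem hm x)).congr_of_eventuallyEq ?_
  filter_upwards [hev] with y hy
  rw [hy]

/-- The glued function is continuous and differentiable off the countable set of interfaces, which
suffices for the fundamental theorem of calculus. -/
theorem apply_layerIndex_eq_add_integral (hb : ∀ j < m, b j < b (j + 1)) (hm : 1 ≤ m)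
    {F F' : ℕ → ℝ → ℂ} (hF : ∀ j ∈ Finset.Icc 1 m, ∀ x, HasDerivAt (F j) (F' j x) x)
    (hmatch : ∀ j ∈ Finset.Ico 1 m, F j (b j) = F (j + 1) (b j)) {x : ℝ}
    (hint : IntervalIntegrable (fun x => F' (layerIndex m b x) x) volume 0 x) :
    F (layerIndex m b x) x =
      F (layerIndex m b 0) 0 + ∫ ξ in (0 : ℝ)..x, F' (layerIndex m b ξ) ξ := by
  have hc : Continuous fun x => F (layerIndex m b x) x := continuous_apply_layerIndex hb hm
    (fun j hj => continuous_iff_continuousAt.2 fun x => (hF j hj x).continuousAt) hmatch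
  rw [integral_eq_of_hasDerivAt_off_countable _ _ (countable_range b) hc.continuousOn
    (fun y hy => hasDerivAt_apply_layerIndex hm (fun j hj => hF j hj y) hy.2) hint]
  ring

theorem exists_norm_apply_layerIndex_le {F : ℕ → ℝ → ℂ} (hm : 1 ≤ m)
    (hF : ∀ j ∈ Finset.Icc 1 m, Continuous (F j)) (r s : ℝ) :
    ∃ K, ∀ x ∈ Icc r s, ‖F (layerIndex m b x) x‖ ≤ K := by
  have h : ∀ j, ∃ K, j ∈ Finset.Icc 1 m → ∀ x ∈ Icc r s, ‖F j x‖ ≤ K := fun j => by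
    by_cases hj : j ∈ Finset.Icc 1 m
    · obtain ⟨K, hK⟩ := isCompact_Icc.exists_bound_of_continuousOn (hF j hj).continuousOn
        (s := Icc r s)
      exact ⟨K, fun _ => hK⟩
    · exact ⟨0, fun h => absurd h hj⟩
  choose K hK using h
  refine ⟨∑ j ∈ Finset.Icc 1 m, |K j|, fun x hx =>
    ((hK _ (layerIndex_mem hm x) x hx).trans (le_abs_self _)).trans ?_⟩
  exact Finset.single_le_sum (f := fun j => |K j|) (fun _ _ => abs_nonneg _)
    (layerIndex_mem hm x)

end Layers

/-! ### Waves in the layers -/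

/-- The flux `κ w'` of `w = layerWave κ z A B`, divided by `z`. -/
noncomputable def layerFlux (κ : ℝ) (z A B : ℂ) (x : ℝ) : ℂ :=
  (Real.sqrt κ : ℂ) * (A * Complex.exp ((x : ℂ) * (z / (Real.sqrt κ : ℂ))) -
    B * Complex.exp (-((x : ℂ) * (z / (Real.sqrt κ : ℂ)))))

theorem layerFlux_eq_mul_layerWave (κ : ℝ) (z A B : ℂ) :
    layerFlux κ z A B = fun x => (Real.sqrt κ : ℂ) * layerWave κ z A (-B) x := by
  funext x
  simp only [layerFlux, layerWave]
  ring

/-- With the flux divided by z, the stationary equation becomes the first-order system w' = (z/κ) F,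
F' = z w; the second half is `hasDerivAt_layerFlux`. -/
theorem hasDerivAt_layerWave {κ : ℝ} (hκ : 0 < κ) (z A B : ℂ) (x : ℝ) :
    HasDerivAt (layerWave κ z A B) (z / κ * layerFlux κ z A B x) x := by
  have hs : (Real.sqrt κ : ℂ) ≠ 0 := by exact_mod_cast (Real.sqrt_pos.2 hκ).ne'
  have hss : (κ : ℂ) = (Real.sqrt κ : ℂ) * Real.sqrt κ := by
    exact_mod_cast (Real.mul_self_sqrt hκ.le).symm
  have h1 : HasDerivAt (fun y : ℝ => (y : ℂ) * (z / (Real.sqrt κ : ℂ)))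
      (z / (Real.sqrt κ : ℂ)) x := by
    simpa using (Complex.ofRealCLM.hasDerivAt (x := x)).mul_const (z / (Real.sqrt κ : ℂ))
  have h2 : HasDerivAt (layerWave κ z A B) _ x :=
    (h1.cexp.const_mul A).add (h1.fun_neg.cexp.const_mul B)
  refine h2.congr_deriv ?_
  simp only [layerFlux, hss]
  field_simp
  ring

theorem continuous_layerWave {κ : ℝ} (hκ : 0 < κ) (z A B : ℂ) : Continuous (layerWave κ z A B) :=
  continuous_iff_continuousAt.2 fun x => (hasDerivAt_layerWave hκ z A B x).continuousAt

theorem continuous_layerFlux {κ : ℝ} (hκ : 0 < κ) (z A B : ℂ) :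
    Continuous (layerFlux κ z A B) := by
  rw [layerFlux_eq_mul_layerWave]
  exact (continuous_layerWave hκ z A (-B)).const_mul _

theorem hasDerivAt_layerFlux {κ : ℝ} (hκ : 0 < κ) (z A B : ℂ) (x : ℝ) :
    HasDerivAt (layerFlux κ z A B) (z * layerWave κ z A B x) x := by
  have hs : (Real.sqrt κ : ℂ) ≠ 0 := by exact_mod_cast (Real.sqrt_pos.2 hκ).ne'
  have hss : (κ : ℂ) = (Real.sqrt κ : ℂ) * Real.sqrt κ := by
    exact_mod_cast (Real.mul_self_sqrt hκ.le).symm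
  rw [layerFlux_eq_mul_layerWave]
  refine ((hasDerivAt_layerWave hκ z A (-B) x).const_mul (Real.sqrt κ : ℂ)).congr_deriv ?_
  simp only [layerFlux, layerWave, hss]
  field_simp
  ring

end LayeredHeat

namespace LayeredHeat

/-! ### The weak formulation with complex test functions -/

theorem integral_mul_re_add_I_mul_im {T : ℝ} {F Θ : ℝ → ℂ}
    (hF : IntervalIntegrable F volume 0 T) (hΘ : Continuous Θ) :
    (∫ t in (0 : ℝ)..T, F t * ((Θ t).re : ℂ)) +
      Complex.I * (∫ t in (0 : ℝ)..T, F t * ((Θ t).im : ℂ)) = ∫ t in (0 : ℝ)..T, F t * Θ t := by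
  rw [← intervalIntegral.integral_const_mul, ← intervalIntegral.integral_add]
  · refine intervalIntegral.integral_congr fun t _ => ?_
    conv_rhs => rw [← Complex.re_add_im (Θ t)]
    ring
  · exact hF.mul_continuousOn
      (Complex.continuous_ofReal.comp (Complex.continuous_re.comp hΘ)).continuousOn
  · exact (hF.mul_continuousOn
      (Complex.continuous_ofReal.comp (Complex.continuous_im.comp hΘ)).continuousOn).const_mul _

/-- The identity is linear in the test function, so real and imaginary parts can be tested
separately. Complex test functions are needed because e^{-z²t} is complex. -/
theorem weak_identity_of_real {T : ℝ} {F₁ F₂ F₃ F₄ : ℝ → ℂ} {r s : ℂ}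
    (h₁ : IntervalIntegrable F₁ volume 0 T) (h₂ : IntervalIntegrable F₂ volume 0 T)
    (h₃ : IntervalIntegrable F₃ volume 0 T) (h₄ : IntervalIntegrable F₄ volume 0 T)
    (h : ∀ θ : ℝ → ℝ, ContDiff ℝ ∞ θ → (∃ s < T, ∀ t, s ≤ t → θ t = 0) →
      -(∫ t in (0 : ℝ)..T, F₁ t * ((deriv θ t : ℝ) : ℂ)) + (∫ t in (0 : ℝ)..T, F₂ t * (θ t : ℂ))
        + r * (∫ t in (0 : ℝ)..T, F₃ t * (θ t : ℂ))
        + s * (∫ t in (0 : ℝ)..T, F₄ t * (θ t : ℂ)) = 0)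
    {Θ : ℝ → ℂ} (hΘ : ContDiff ℝ ∞ Θ) (hΘ0 : ∃ s < T, ∀ t, s ≤ t → Θ t = 0) :
    -(∫ t in (0 : ℝ)..T, F₁ t * deriv Θ t) + (∫ t in (0 : ℝ)..T, F₂ t * Θ t)
        + r * (∫ t in (0 : ℝ)..T, F₃ t * Θ t) + s * (∫ t in (0 : ℝ)..T, F₄ t * Θ t) = 0 := by
  obtain ⟨σ, hσ, hΘσ⟩ := hΘ0
  have hd : ∀ t, HasDerivAt Θ (deriv Θ t) t := fun t =>
    (hΘ.differentiable (by simp) t).hasDerivAt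
  have hdre : ∀ t, deriv (fun t => (Θ t).re) t = (deriv Θ t).re := fun t =>
    (Complex.reCLM.hasFDerivAt.comp_hasDerivAt t (hd t)).deriv
  have hdim : ∀ t, deriv (fun t => (Θ t).im) t = (deriv Θ t).im := fun t =>
    (Complex.imCLM.hasFDerivAt.comp_hasDerivAt t (hd t)).deriv
  have hre := h (fun t => (Θ t).re) (Complex.reCLM.contDiff.comp hΘ)
    ⟨σ, hσ, fun t ht => by simp [hΘσ t ht]⟩
  have him := h (fun t => (Θ t).im) (Complex.imCLM.contDiff.comp hΘ)
    ⟨σ, hσ, fun t ht => by simp [hΘσ t ht]⟩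
  simp only [hdre, hdim] at hre him
  rw [← integral_mul_re_add_I_mul_im h₁ (hΘ.continuous_deriv (by simp)),
    ← integral_mul_re_add_I_mul_im h₂ hΘ.continuous,
    ← integral_mul_re_add_I_mul_im h₃ hΘ.continuous,
    ← integral_mul_re_add_I_mul_im h₄ hΘ.continuous]
  linear_combination hre + Complex.I * him

/-! ### Integrability of traces and of moments -/

/-- An L² function on the bounded rectangle is integrable, and Fubini applies after multiplication
by a bounded weight. -/
theorem intervalIntegrable_integral_mul {a T : ℝ} (ha : 0 ≤ a) (hT : 0 ≤ T) {f : ℝ → ℝ → ℂ}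
    (hf : MemLp (fun p : ℝ × ℝ => f p.1 p.2) 2 (volume.restrict (Ioo 0 a ×ˢ Ioo 0 T)))
    {w : ℝ → ℂ} (hw : Measurable w) {K : ℝ} (hK : ∀ x ∈ Icc 0 a, ‖w x‖ ≤ K) :
    IntervalIntegrable (fun t => ∫ x in (0 : ℝ)..a, f x t * w x) volume 0 T := by
  have : IsFiniteMeasure ((volume : Measure (ℝ × ℝ)).restrict (Ioo 0 a ×ˢ Ioo 0 T)) := by
    refine ⟨?_⟩
    rw [Measure.restrict_apply_univ, Measure.volume_eq_prod, Measure.prod_prod]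
    simp [Real.volume_Ioo, ENNReal.mul_lt_top]
  have h1 : Integrable (fun p : ℝ × ℝ => f p.1 p.2 * w p.1)
      (volume.restrict (Ioo 0 a ×ˢ Ioo 0 T)) := by
    refine (hf.integrable (by norm_num)).mul_bdd (c := K)
      (hw.comp measurable_fst).aestronglyMeasurable ?_
    filter_upwards [ae_restrict_mem (measurableSet_Ioo.prod measurableSet_Ioo)] with p hp
    exact hK _ (Ioo_subset_Icc_self hp.1)
  rw [Measure.volume_eq_prod, ← Measure.prod_restrict] at h1
  have h2 := h1.integral_prod_right
  rw [intervalIntegrable_iff_integrableOn_Ioc_of_le hT, integrableOn_Ioc_iff_integrableOn_Ioo]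
  refine h2.congr (ae_of_all _ fun t => ?_)
  change (∫ x in Ioo 0 a, f x t * w x) = ∫ x in (0 : ℝ)..a, f x t * w x
  rw [intervalIntegral.integral_of_le ha, integral_Ioc_eq_integral_Ioo]

theorem IsH1.intervalIntegrable {a : ℝ} (ha : 0 ≤ a) {φ φ' : ℝ → ℂ} (h : IsH1 a φ φ') :
    IntervalIntegrable φ' volume 0 a := by
  rw [intervalIntegrable_iff_integrableOn_Ioc_of_le ha, integrableOn_Ioc_iff_integrableOn_Ioo]
  exact h.1.integrable (by norm_num)

/-- Integrate (xφ)' over [0, a]. Traces thereby become integrals over the interval, which is how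
integrability of the traces of u in t is obtained. -/
theorem IsH1.trace_right {a : ℝ} (ha : 0 < a) {φ φ' : ℝ → ℂ} (h : IsH1 a φ φ') :
    φ a = (a : ℂ)⁻¹ * ((∫ x in (0 : ℝ)..a, φ' x * (x : ℂ)) + ∫ x in (0 : ℝ)..a, φ x * 1) := by
  have key := integral_mul_deriv_add_deriv_mul_of_primitive ha.le (p := fun _ => 1)
    (P := fun x => (x : ℂ)) intervalIntegrable_const (h.intervalIntegrable ha.le)
    (fun x _ => by simp) h.2
  have ha' : (a : ℂ) ≠ 0 := by exact_mod_cast ha.ne'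
  simp only [one_mul, Complex.ofReal_zero, zero_mul, sub_zero] at key
  simp only [mul_one, mul_comm (φ' _)]
  rw [key]
  field_simp

theorem IsH1.trace_left {a : ℝ} (ha : 0 < a) {φ φ' : ℝ → ℂ} (h : IsH1 a φ φ') :
    φ 0 = φ a - ∫ x in (0 : ℝ)..a, φ' x * 1 := by
  simp only [mul_one]
  rw [h.2 a ⟨ha.le, le_rfl⟩]
  ring

theorem MemL2H1.intervalIntegrable_trace_right {a T : ℝ} (ha : 0 < a) (hT : 0 ≤ T)
    {u ux : ℝ → ℝ → ℂ} (h : MemL2H1 a T u ux) :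
    IntervalIntegrable (fun t => u a t) volume 0 T := by
  have h1 := intervalIntegrable_integral_mul ha.le hT h.memLp_deriv
    (Complex.measurable_ofReal) (K := a)
    (fun x hx => by rw [Complex.norm_real, Real.norm_of_nonneg hx.1]; exact hx.2)
  have h2 := intervalIntegrable_integral_mul ha.le hT h.memLp
    (measurable_const (a := (1 : ℂ))) (K := 1) (fun x _ => by simp)
  refine ((h1.add h2).const_mul (a : ℂ)⁻¹).congr_ae ?_
  rw [uIoc_of_le hT, restrict_Ioo_eq_restrict_Ioc.symm]
  filter_upwards [h.isH1] with t ht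
  exact (ht.trace_right ha).symm

theorem MemL2H1.intervalIntegrable_trace_left {a T : ℝ} (ha : 0 < a) (hT : 0 ≤ T)
    {u ux : ℝ → ℝ → ℂ} (h : MemL2H1 a T u ux) :
    IntervalIntegrable (fun t => u 0 t) volume 0 T := by
  have h2 := intervalIntegrable_integral_mul ha.le hT h.memLp_deriv
    (measurable_const (a := (1 : ℂ))) (K := 1) (fun x _ => by simp)
  refine ((h.intervalIntegrable_trace_right ha hT).sub h2).congr_ae ?_
  rw [uIoc_of_le hT, restrict_Ioo_eq_restrict_Ioc.symm]
  filter_upwards [h.isH1] with t ht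
  exact (ht.trace_left ha).symm

/-! ### Testing with a solution of the stationary equation -/

/-- The function equal to `A_j e^{x z_j} + B_j e^{-x z_j}` in the `j`-th layer and its flux are
continuous across the interfaces. -/
structure IsMatched (m : ℕ) (γ b : ℕ → ℝ) (z : ℂ) (A B : ℕ → ℂ) : Prop where
  wave : ∀ j ∈ Finset.Ico 1 m,
    layerWave (γ j) z (A j) (B j) (b j) = layerWave (γ (j + 1)) z (A (j + 1)) (B (j + 1)) (b j)
  flux : ∀ j ∈ Finset.Ico 1 m,
    layerFlux (γ j) z (A j) (B j) (b j) = layerFlux (γ (j + 1)) z (A (j + 1)) (B (j + 1)) (b j)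

/-- The function given by `A_j e^{x z_j} + B_j e^{-x z_j}` in the `j`-th layer. -/
noncomputable def gluedWave (m : ℕ) (γ b : ℕ → ℝ) (z : ℂ) (A B : ℕ → ℂ) (x : ℝ) : ℂ :=
  layerWave (γ (layerIndex m b x)) z (A (layerIndex m b x)) (B (layerIndex m b x)) x

/-- The flux of `gluedWave`, divided by `z`. -/
noncomputable def gluedFlux (m : ℕ) (γ b : ℕ → ℝ) (z : ℂ) (A B : ℕ → ℂ) (x : ℝ) : ℂ :=
  layerFlux (γ (layerIndex m b x)) z (A (layerIndex m b x)) (B (layerIndex m b x)) x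

/-- The derivative of `gluedWave`. -/
noncomputable def gluedDeriv (m : ℕ) (γ b : ℕ → ℝ) (z : ℂ) (A B : ℕ → ℂ) (x : ℝ) : ℂ :=
  z / (conductivity m γ b x : ℂ) * gluedFlux m γ b z A B x

section Glued

variable {m : ℕ} {γ b : ℕ → ℝ} {z : ℂ} {A B : ℕ → ℂ}

theorem continuous_gluedWave (hm : 1 ≤ m) (hγ : ∀ j ∈ Finset.Icc 1 m, 0 < γ j)
    (hb : ∀ j < m, b j < b (j + 1)) (h : IsMatched m γ b z A B) :
    Continuous (gluedWave m γ b z A B) :=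
  continuous_apply_layerIndex hb hm (F := fun j x => layerWave (γ j) z (A j) (B j) x)
    (fun j hj => continuous_layerWave (hγ j hj) z _ _) h.wave

theorem measurable_gluedDeriv (hm : 1 ≤ m) (hγ : ∀ j ∈ Finset.Icc 1 m, 0 < γ j)
    (hb : ∀ j < m, b j < b (j + 1)) : Measurable (gluedDeriv m γ b z A B) :=
  measurable_apply_layerIndex hb hm
    (F := fun j x => z / (γ j : ℂ) * layerFlux (γ j) z (A j) (B j) x)
    fun j hj => ((continuous_layerFlux (hγ j hj) z _ _).const_mul _).measurable

theorem exists_norm_gluedDeriv_le (hm : 1 ≤ m) (hγ : ∀ j ∈ Finset.Icc 1 m, 0 < γ j) :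
    ∃ K, ∀ x ∈ Icc 0 (b m), ‖gluedDeriv m γ b z A B x‖ ≤ K :=
  exists_norm_apply_layerIndex_le hm
    (F := fun j x => z / (γ j : ℂ) * layerFlux (γ j) z (A j) (B j) x)
    (fun j hj => (continuous_layerFlux (hγ j hj) z _ _).const_mul _) 0 (b m)

theorem intervalIntegrable_gluedDeriv (hm : 1 ≤ m) (hγ : ∀ j ∈ Finset.Icc 1 m, 0 < γ j)
    (hb : ∀ j < m, b j < b (j + 1)) (x : ℝ) :
    IntervalIntegrable (gluedDeriv m γ b z A B) volume 0 x := by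
  obtain ⟨K, hK⟩ := exists_norm_apply_layerIndex_le (b := b) hm
    (F := fun j x => z / (γ j : ℂ) * layerFlux (γ j) z (A j) (B j) x)
    (fun j hj => (continuous_layerFlux (hγ j hj) z _ _).const_mul _) (min 0 x) (max 0 x)
  rw [intervalIntegrable_iff]
  refine Measure.integrableOn_of_bounded (M := K) (by simp)
    (measurable_gluedDeriv hm hγ hb).aestronglyMeasurable ?_
  filter_upwards [ae_restrict_mem measurableSet_uIoc] with y hy
  exact hK y (uIoc_subset_uIcc hy)

theorem isH1_gluedWave (hm : 1 ≤ m) (hγ : ∀ j ∈ Finset.Icc 1 m, 0 < γ j)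
    (hb : ∀ j < m, b j < b (j + 1)) (h : IsMatched m γ b z A B) :
    IsH1 (b m) (gluedWave m γ b z A B) (gluedDeriv m γ b z A B) := by
  refine ⟨?_, fun x hx => ?_⟩
  · obtain ⟨K, hK⟩ := exists_norm_gluedDeriv_le (b := b) (z := z) (A := A) (B := B) hm hγ
    refine MemLp.of_bound (measurable_gluedDeriv hm hγ hb).aestronglyMeasurable K ?_
    filter_upwards [ae_restrict_mem measurableSet_Ioo] with x hx
    exact hK x (Ioo_subset_Icc_self hx)
  · exact apply_layerIndex_eq_add_integral hb hm
      (F := fun j x => layerWave (γ j) z (A j) (B j) x)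
      (fun j hj x => hasDerivAt_layerWave (hγ j hj) z _ _ x) h.wave
      (intervalIntegrable_gluedDeriv hm hγ hb x)

theorem gluedFlux_eq_add_integral (hm : 1 ≤ m) (hγ : ∀ j ∈ Finset.Icc 1 m, 0 < γ j)
    (hb : ∀ j < m, b j < b (j + 1)) (h : IsMatched m γ b z A B) (x : ℝ) :
    gluedFlux m γ b z A B x =
      gluedFlux m γ b z A B 0 + ∫ ξ in (0 : ℝ)..x, z * gluedWave m γ b z A B ξ :=
  apply_layerIndex_eq_add_integral hb hm
    (F := fun j x => layerFlux (γ j) z (A j) (B j) x)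
    (fun j hj x => hasDerivAt_layerFlux (hγ j hj) z _ _ x) h.flux
    ((continuous_gluedWave hm hγ hb h).const_mul z |>.intervalIntegrable _ _)

/-- The conductivity times the derivative of the wave is z times its flux, an absolutely continuous
function even where the conductivity jumps; moving the derivative off U uses F' = z w. -/
theorem integral_conductivity_mul_deriv_mul (hm : 1 ≤ m) (hγ : ∀ j ∈ Finset.Icc 1 m, 0 < γ j)
    (hb : ∀ j < m, b j < b (j + 1)) (ha : 0 ≤ b m) (h : IsMatched m γ b z A B)
    {U U' : ℝ → ℂ} (hU : IsH1 (b m) U U') :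
    ∫ x in (0 : ℝ)..(b m), (conductivity m γ b x : ℂ) * U' x * gluedDeriv m γ b z A B x =
      z * (gluedFlux m γ b z A B (b m) * U (b m) - gluedFlux m γ b z A B 0 * U 0)
        - z ^ 2 * ∫ x in (0 : ℝ)..(b m), U x * gluedWave m γ b z A B x := by
  have key := integral_mul_deriv_add_deriv_mul_of_primitive ha
    ((continuous_gluedWave hm hγ hb h).const_mul z |>.intervalIntegrable 0 (b m))
    (hU.intervalIntegrable ha) (fun x _ => gluedFlux_eq_add_integral hm hγ hb h x) hU.2
  have h1 : ∫ x in (0 : ℝ)..(b m), (conductivity m γ b x : ℂ) * U' x * gluedDeriv m γ b z A B x =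
      z * ∫ x in (0 : ℝ)..(b m), gluedFlux m γ b z A B x * U' x := by
    rw [← intervalIntegral.integral_const_mul]
    refine intervalIntegral.integral_congr fun x _ => ?_
    have : (conductivity m γ b x : ℂ) ≠ 0 := by
      exact_mod_cast (hγ _ (layerIndex_mem hm x)).ne'
    simp only [gluedDeriv]
    field_simp
  have h2 : ∫ x in (0 : ℝ)..(b m), z * gluedWave m γ b z A B x * U x =
      z * ∫ x in (0 : ℝ)..(b m), U x * gluedWave m γ b z A B x := by
    rw [← intervalIntegral.integral_const_mul]
    refine intervalIntegral.integral_congr fun x _ => ?_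
    ring
  rw [h2] at key
  rw [h1]
  linear_combination z * key

theorem gluedWave_zero (hm : 1 ≤ m) (hb : ∀ j < m, b j < b (j + 1)) (hb0 : b 0 = 0) :
    gluedWave m γ b z A B 0 = layerWave (γ 1) z (A 1) (B 1) 0 := by
  have : layerIndex m b 0 = 1 := layerIndex_eq_one hb hm (hb0 ▸ hb 0 (by omega))
  rw [gluedWave, this]

theorem gluedFlux_zero (hm : 1 ≤ m) (hb : ∀ j < m, b j < b (j + 1)) (hb0 : b 0 = 0) :
    gluedFlux m γ b z A B 0 = layerFlux (γ 1) z (A 1) (B 1) 0 := by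
  have : layerIndex m b 0 = 1 := layerIndex_eq_one hb hm (hb0 ▸ hb 0 (by omega))
  rw [gluedFlux, this]

theorem gluedWave_last (hm : 1 ≤ m) (hb : ∀ j < m, b j < b (j + 1)) :
    gluedWave m γ b z A B (b m) = layerWave (γ m) z (A m) (B m) (b m) := by
  rw [gluedWave, layerIndex_eq_last hb hm]

theorem gluedFlux_last (hm : 1 ≤ m) (hb : ∀ j < m, b j < b (j + 1)) :
    gluedFlux m γ b z A B (b m) = layerFlux (γ m) z (A m) (B m) (b m) := by
  rw [gluedFlux, layerIndex_eq_last hb hm]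

/-- Testing the weak formulation with a stationary solution that satisfies the boundary condition
on the right expresses the trace `u(0,·)` through the Neumann data `g`. -/
theorem IsHeatSolution.test_gluedWave (hm : 1 ≤ m) (hγ : ∀ j ∈ Finset.Icc 1 m, 0 < γ j)
    (hb : ∀ j < m, b j < b (j + 1)) (hb0 : b 0 = 0) {ρ T : ℝ} (hT : 0 ≤ T)
    {u : ℝ → ℝ → ℂ} {g : ℝ → ℂ} (hu : IsHeatSolution m γ b ρ T u g)
    (h : IsMatched m γ b z A B)
    (hbc : z * layerFlux (γ m) z (A m) (B m) (b m) +
      ρ * layerWave (γ m) z (A m) (B m) (b m) = 0)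
    {Θ : ℝ → ℂ} (hΘ : ContDiff ℝ ∞ Θ) (hΘ0 : ∃ s < T, ∀ t, s ≤ t → Θ t = 0) :
    z * layerFlux (γ 1) z (A 1) (B 1) 0 * (∫ t in (0 : ℝ)..T, u 0 t * Θ t) =
      γ 1 * layerWave (γ 1) z (A 1) (B 1) 0 * (∫ t in (0 : ℝ)..T, g t * Θ t) -
      ∫ t in (0 : ℝ)..T, (∫ x in (0 : ℝ)..(b m), u x t * gluedWave m γ b z A B x) *
        (deriv Θ t + z ^ 2 * Θ t) := by
  obtain ⟨ux, hux, hw⟩ := hu.weak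
  have ha : 0 < b m := by
    have := le_of_forall_lt_succ hb (hm) le_rfl
    have := hb 0 (by omega)
    rw [zero_add] at this
    linarith
  set φ := gluedWave m γ b z A B with hφ
  set φ' := gluedDeriv m γ b z A B with hφ'
  have hφH := isH1_gluedWave hm hγ hb h
  have hcφ := continuous_gluedWave hm hγ hb h
  obtain ⟨K, hK⟩ := isCompact_Icc.exists_bound_of_continuousOn hcφ.continuousOn
    (s := Icc 0 (b m))
  have hF₁ : IntervalIntegrable (fun t => ∫ x in (0 : ℝ)..(b m), u x t * φ x) volume 0 T :=
    intervalIntegrable_integral_mul ha.le hT hux.memLp hcφ.measurable hK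
  have hTr0 := hux.intervalIntegrable_trace_left ha hT
  have hTra := hux.intervalIntegrable_trace_right ha hT
  have hG : IntervalIntegrable g volume 0 T := by
    rw [intervalIntegrable_iff_integrableOn_Ioc_of_le hT, integrableOn_Ioc_iff_integrableOn_Ioo]
    exact hu.flux_memLp.integrable (by norm_num)
  have hae : ∀ᵐ t ∂(volume.restrict (uIoc 0 T)),
      z * (gluedFlux m γ b z A B (b m) * u (b m) t - gluedFlux m γ b z A B 0 * u 0 t)
        - z ^ 2 * (∫ x in (0 : ℝ)..(b m), u x t * φ x) =
      ∫ x in (0 : ℝ)..(b m), (conductivity m γ b x : ℂ) * ux x t * φ' x := by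
    rw [uIoc_of_le hT, restrict_Ioo_eq_restrict_Ioc.symm]
    filter_upwards [hux.isH1] with t ht
    exact (integral_conductivity_mul_deriv_mul hm hγ hb ha.le h ht).symm
  -- Integrability in t of the conductivity term is obtained from this almost everywhere equal
  -- combination of traces and a moment.
  have hsmall : IntervalIntegrable (fun t =>
      z * (gluedFlux m γ b z A B (b m) * u (b m) t - gluedFlux m γ b z A B 0 * u 0 t)
        - z ^ 2 * (∫ x in (0 : ℝ)..(b m), u x t * φ x)) volume 0 T :=
    (((hTra.const_mul _).sub (hTr0.const_mul _)).const_mul _).sub (hF₁.const_mul _)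
  have key := weak_identity_of_real hF₁ (hsmall.congr_ae hae) (hTra.mul_const (φ (b m)))
    (hG.mul_const (φ 0)) (hw φ φ' hφH) hΘ hΘ0
  have hcΘ := hΘ.continuous
  have hcΘ' := hΘ.continuous_deriv (by simp)
  have e2 : ∫ t in (0 : ℝ)..T,
      (∫ x in (0 : ℝ)..(b m), (conductivity m γ b x : ℂ) * ux x t * φ' x) * Θ t =
      z * gluedFlux m γ b z A B (b m) * (∫ t in (0 : ℝ)..T, u (b m) t * Θ t)
      - z * gluedFlux m γ b z A B 0 * (∫ t in (0 : ℝ)..T, u 0 t * Θ t)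
      - z ^ 2 * (∫ t in (0 : ℝ)..T, (∫ x in (0 : ℝ)..(b m), u x t * φ x) * Θ t) := by
    rw [← intervalIntegral.integral_const_mul, ← intervalIntegral.integral_const_mul,
      ← intervalIntegral.integral_const_mul, ← intervalIntegral.integral_sub,
      ← intervalIntegral.integral_sub]
    · refine intervalIntegral.integral_congr_ae_restrict ?_
      filter_upwards [hae] with t ht
      rw [← ht]
      ring
    · exact ((hTra.mul_continuousOn hcΘ.continuousOn).const_mul _).sub
        ((hTr0.mul_continuousOn hcΘ.continuousOn).const_mul _)
    · exact (hF₁.mul_continuousOn hcΘ.continuousOn).const_mul _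
    · exact (hTra.mul_continuousOn hcΘ.continuousOn).const_mul _
    · exact (hTr0.mul_continuousOn hcΘ.continuousOn).const_mul _
  have e3 : ∫ t in (0 : ℝ)..T, u (b m) t * φ (b m) * Θ t =
      φ (b m) * ∫ t in (0 : ℝ)..T, u (b m) t * Θ t := by
    rw [← intervalIntegral.integral_const_mul]
    refine intervalIntegral.integral_congr fun x _ => ?_
    ring
  have e4 : ∫ t in (0 : ℝ)..T, g t * φ 0 * Θ t = φ 0 * ∫ t in (0 : ℝ)..T, g t * Θ t := by
    rw [← intervalIntegral.integral_const_mul]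
    refine intervalIntegral.integral_congr fun x _ => ?_
    ring
  have e1 : ∫ t in (0 : ℝ)..T, (∫ x in (0 : ℝ)..(b m), u x t * φ x) *
        (deriv Θ t + z ^ 2 * Θ t) =
      (∫ t in (0 : ℝ)..T, (∫ x in (0 : ℝ)..(b m), u x t * φ x) * deriv Θ t) +
      z ^ 2 * ∫ t in (0 : ℝ)..T, (∫ x in (0 : ℝ)..(b m), u x t * φ x) * Θ t := by
    rw [← intervalIntegral.integral_const_mul, ← intervalIntegral.integral_add]
    · refine intervalIntegral.integral_congr fun x _ => ?_
      ring
    · exact hF₁.mul_continuousOn hcΘ'.continuousOn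
    · exact (hF₁.mul_continuousOn hcΘ.continuousOn).const_mul _
  rw [e2, e3, e4, hφ, gluedWave_zero hm hb hb0, gluedWave_last hm hb, gluedFlux_last hm hb,
    gluedFlux_zero hm hb hb0, ← hφ] at key
  rw [e1]
  -- The Robin condition of the test wave cancels every occurrence of the trace of u at b_m.
  linear_combination (-1 : ℂ) * key + (∫ t in (0 : ℝ)..T, u (b m) t * Θ t) * hbc

end Glued

end LayeredHeat

namespace LayeredHeat

/-! ### Algebra of matched coefficients -/

section Algebra

variable {m : ℕ} {γ b : ℕ → ℝ} {z : ℂ} {A B A' B' : ℕ → ℂ}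

theorem sqrt_ne_zero_of_mem (hγ : ∀ j ∈ Finset.Icc 1 m, 0 < γ j) {j : ℕ}
    (hj : j ∈ Finset.Icc 1 m) : (Real.sqrt (γ j) : ℂ) ≠ 0 := by
  exact_mod_cast (Real.sqrt_pos.2 (hγ j hj)).ne'

/-- The Wronskian contains only products e^{xz_j} e^{-xz_j} = 1 after cancellation, so it does not
depend on x. -/
theorem layerWave_mul_layerFlux_sub (κ : ℝ) (z A B A' B' : ℂ) (x : ℝ) :
    layerWave κ z A B x * layerFlux κ z A' B' x - layerFlux κ z A B x * layerWave κ z A' B' x =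
      2 * Real.sqrt κ * (B * A' - A * B') := by
  have h : Complex.exp ((x : ℂ) * (z / (Real.sqrt κ : ℂ))) *
      Complex.exp (-((x : ℂ) * (z / (Real.sqrt κ : ℂ)))) = 1 := by
    rw [← Complex.exp_add, add_neg_cancel, Complex.exp_zero]
  simp only [layerWave, layerFlux]
  linear_combination 2 * (Real.sqrt κ : ℂ) * (B * A' - A * B') * h

/-- Constant inside each layer, the Wronskian also passes unchanged through an interface, being
built from values and fluxes that match there. -/
theorem IsMatched.wronskian_eq (h : IsMatched m γ b z A B) (h' : IsMatched m γ b z A' B') {j : ℕ}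
    (h1 : 1 ≤ j) (hj : j ≤ m) :
    (Real.sqrt (γ 1) : ℂ) * (B 1 * A' 1 - A 1 * B' 1) =
      Real.sqrt (γ j) * (B j * A' j - A j * B' j) := by
  induction j, h1 using Nat.le_induction with
  | base => rfl
  | succ k hk ih =>
    rw [ih (by omega)]
    have hk' : k ∈ Finset.Ico 1 m := Finset.mem_Ico.2 ⟨hk, by omega⟩
    have e1 := layerWave_mul_layerFlux_sub (γ k) z (A k) (B k) (A' k) (B' k) (b k)
    have e2 := layerWave_mul_layerFlux_sub (γ (k + 1)) z (A (k + 1)) (B (k + 1)) (A' (k + 1))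
      (B' (k + 1)) (b k)
    rw [h.wave k hk', h.flux k hk', h'.wave k hk', h'.flux k hk', e2] at e1
    linear_combination (-1 / 2 : ℂ) * e1

/-- The coefficients of a wave in terms of its value and its flux at `x`. -/
theorem coeff_eq_of_layerWave {κ : ℝ} (hκ : (Real.sqrt κ : ℂ) ≠ 0) (z A B : ℂ) (x : ℝ) :
    A = Complex.exp (-((x : ℂ) * (z / (Real.sqrt κ : ℂ)))) *
        ((layerWave κ z A B x + layerFlux κ z A B x / Real.sqrt κ) / 2) ∧
      B = Complex.exp ((x : ℂ) * (z / (Real.sqrt κ : ℂ))) *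
        ((layerWave κ z A B x - layerFlux κ z A B x / Real.sqrt κ) / 2) := by
  have h : Complex.exp ((x : ℂ) * (z / (Real.sqrt κ : ℂ))) *
      Complex.exp (-((x : ℂ) * (z / (Real.sqrt κ : ℂ)))) = 1 := by
    rw [← Complex.exp_add, add_neg_cancel, Complex.exp_zero]
  rw [layerFlux, mul_div_cancel_left₀ _ hκ, layerWave]
  constructor
  · linear_combination (-A) * h
  · linear_combination (-B) * h

theorem layerWave_of_value_flux {κ : ℝ} (hκ : (Real.sqrt κ : ℂ) ≠ 0) (z W F : ℂ) (x : ℝ) :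
    layerWave κ z (Complex.exp (-((x : ℂ) * (z / (Real.sqrt κ : ℂ)))) * ((W + F / Real.sqrt κ) / 2))
        (Complex.exp ((x : ℂ) * (z / (Real.sqrt κ : ℂ))) * ((W - F / Real.sqrt κ) / 2)) x = W ∧
      layerFlux κ z
        (Complex.exp (-((x : ℂ) * (z / (Real.sqrt κ : ℂ)))) * ((W + F / Real.sqrt κ) / 2))
        (Complex.exp ((x : ℂ) * (z / (Real.sqrt κ : ℂ))) * ((W - F / Real.sqrt κ) / 2)) x = F := by
  have h : Complex.exp ((x : ℂ) * (z / (Real.sqrt κ : ℂ))) *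
      Complex.exp (-((x : ℂ) * (z / (Real.sqrt κ : ℂ)))) = 1 := by
    rw [← Complex.exp_add, add_neg_cancel, Complex.exp_zero]
  have h2 : (Real.sqrt κ : ℂ) * (F / Real.sqrt κ) = F := mul_div_cancel₀ F hκ
  simp only [layerWave, layerFlux]
  constructor
  · linear_combination W * h
  · linear_combination (Real.sqrt κ : ℂ) * (F / Real.sqrt κ) * h + h2

/-- The value and flux at an interface determine both coefficients in the next layer. -/
theorem IsMatched.ext_of_one (hγ : ∀ j ∈ Finset.Icc 1 m, 0 < γ j)
    (h : IsMatched m γ b z A B) (h' : IsMatched m γ b z A' B') (hA : A 1 = A' 1)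
    (hB : B 1 = B' 1) {j : ℕ} (h1 : 1 ≤ j) (hj : j ≤ m) : A j = A' j ∧ B j = B' j := by
  induction j, h1 using Nat.le_induction with
  | base => exact ⟨hA, hB⟩
  | succ k hk ih =>
    have hk' : k ∈ Finset.Ico 1 m := Finset.mem_Ico.2 ⟨hk, by omega⟩
    obtain ⟨ihA, ihB⟩ := ih (by omega)
    have hs := sqrt_ne_zero_of_mem hγ (Finset.mem_Icc.2 ⟨by omega, hj⟩ : k + 1 ∈ Finset.Icc 1 m)
    have e := coeff_eq_of_layerWave hs z (A (k + 1)) (B (k + 1)) (b k)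
    have e' := coeff_eq_of_layerWave hs z (A' (k + 1)) (B' (k + 1)) (b k)
    rw [← h.wave k hk', ← h.flux k hk', ihA, ihB] at e
    rw [← h'.wave k hk', ← h'.flux k hk'] at e'
    exact ⟨e.1.trans e'.1.symm, e.2.trans e'.2.symm⟩

/-- Coefficients in the layers `m, m - 1, …`, computed from those in the last layer. -/
noncomputable def coeffFromLast (m : ℕ) (γ b : ℕ → ℝ) (z : ℂ) (p : ℂ × ℂ) : ℕ → ℂ × ℂ
  | 0 => p
  | k + 1 =>
    let q := coeffFromLast m γ b z p k
    let j := m - (k + 1)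
    let W := layerWave (γ (j + 1)) z q.1 q.2 (b j)
    let F := layerFlux (γ (j + 1)) z q.1 q.2 (b j)
    (Complex.exp (-((b j : ℂ) * (z / (Real.sqrt (γ j) : ℂ)))) * ((W + F / Real.sqrt (γ j)) / 2),
      Complex.exp ((b j : ℂ) * (z / (Real.sqrt (γ j) : ℂ))) * ((W - F / Real.sqrt (γ j)) / 2))

/-- Solve the Cauchy problem from the last layer leftwards. The recursion is indexed by distance
from the last layer, hence the argument m - j. -/
theorem exists_isMatched (hγ : ∀ j ∈ Finset.Icc 1 m, 0 < γ j) (z P Q : ℂ) :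
    ∃ A B : ℕ → ℂ, IsMatched m γ b z A B ∧ A m = P ∧ B m = Q := by
  have key : ∀ j ∈ Finset.Ico 1 m,
      layerWave (γ j) z (coeffFromLast m γ b z (P, Q) (m - j)).1
        (coeffFromLast m γ b z (P, Q) (m - j)).2 (b j) =
      layerWave (γ (j + 1)) z (coeffFromLast m γ b z (P, Q) (m - (j + 1))).1
        (coeffFromLast m γ b z (P, Q) (m - (j + 1))).2 (b j) ∧
      layerFlux (γ j) z (coeffFromLast m γ b z (P, Q) (m - j)).1
        (coeffFromLast m γ b z (P, Q) (m - j)).2 (b j) =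
      layerFlux (γ (j + 1)) z (coeffFromLast m γ b z (P, Q) (m - (j + 1))).1
        (coeffFromLast m γ b z (P, Q) (m - (j + 1))).2 (b j) := by
    intro j hj
    rw [Finset.mem_Ico] at hj
    obtain ⟨k, hk⟩ : ∃ k, m = j + 1 + k := ⟨m - (j + 1), by omega⟩
    have h1 : m - j = k + 1 := by omega
    have h2 : m - (j + 1) = k := by omega
    have h3 : m - (k + 1) = j := by omega
    have hs := sqrt_ne_zero_of_mem hγ (Finset.mem_Icc.2 ⟨hj.1, hj.2.le⟩)
    rw [h1, h2]
    simp only [coeffFromLast, h3]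
    exact layerWave_of_value_flux hs z _ _ (b j)
  exact ⟨fun j => (coeffFromLast m γ b z (P, Q) (m - j)).1,
    fun j => (coeffFromLast m γ b z (P, Q) (m - j)).2,
    ⟨fun j hj => (key j hj).1, fun j hj => (key j hj).2⟩, by simp [coeffFromLast],
    by simp [coeffFromLast]⟩

/-! ### Existence and uniqueness of the coefficients of the special solution -/

theorem mul_deriv_layerWave {κ : ℝ} (hκ : 0 < κ) (z A B : ℂ) (x : ℝ) :
    (κ : ℂ) * deriv (layerWave κ z A B) x = z * layerFlux κ z A B x := by
  have : (κ : ℂ) ≠ 0 := by exact_mod_cast hκ.ne'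
  rw [(hasDerivAt_layerWave hκ z A B x).deriv]
  field_simp

theorem IsLayerCoeff.isMatched (hγ : ∀ j ∈ Finset.Icc 1 m, 0 < γ j) (hz : z ≠ 0)
    (h : IsLayerCoeff m γ b z A B) : IsMatched m γ b z A B := by
  refine ⟨h.continuity, fun j hj => ?_⟩
  have hj' := Finset.mem_Ico.1 hj
  have := h.flux j hj
  rw [mul_deriv_layerWave (hγ j (Finset.mem_Icc.2 ⟨hj'.1, hj'.2.le⟩)),
    mul_deriv_layerWave (hγ (j + 1) (Finset.mem_Icc.2 ⟨by omega, hj'.2⟩))] at this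
  exact mul_left_cancel₀ hz this

/-- Two candidates both have B_m = 0, so their Wronskian vanishes in the last layer and hence in the
first; with A_1 = 1 for both, this forces equal B_1. -/
theorem IsLayerCoeff.unique (hm : 1 ≤ m) (hγ : ∀ j ∈ Finset.Icc 1 m, 0 < γ j) (hz : z ≠ 0)
    (h : IsLayerCoeff m γ b z A B) (h' : IsLayerCoeff m γ b z A' B') : A = A' ∧ B = B' := by
  have hM := h.isMatched hγ hz
  have hM' := h'.isMatched hγ hz
  have hw := hM.wronskian_eq hM' hm le_rfl
  have hB : B 1 = B' 1 := by
    rw [h.first, h'.first, h.last, h'.last, zero_mul, mul_zero, sub_zero, mul_zero, mul_one,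
      one_mul] at hw
    exact sub_eq_zero.1 ((mul_eq_zero.1 hw).resolve_left
      (sqrt_ne_zero_of_mem hγ (Finset.mem_Icc.2 ⟨le_rfl, hm⟩)))
  have key : ∀ j, A j = A' j ∧ B j = B' j := fun j => by
    by_cases hj : j ∈ Finset.Icc 1 m
    · rw [Finset.mem_Icc] at hj
      exact hM.ext_of_one hγ hM' (h.first.trans h'.first.symm) hB hj.1 hj.2
    · rw [(h.outside j hj).1, (h.outside j hj).2, (h'.outside j hj).1, (h'.outside j hj).2]
      exact ⟨rfl, rfl⟩
  exact ⟨funext fun j => (key j).1, funext fun j => (key j).2⟩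

theorem layerWave_mul_left (κ : ℝ) (z r A B : ℂ) (x : ℝ) :
    layerWave κ z (r * A) (r * B) x = r * layerWave κ z A B x := by
  simp only [layerWave]
  ring

theorem layerFlux_mul_left (κ : ℝ) (z r A B : ℂ) (x : ℝ) :
    layerFlux κ z (r * A) (r * B) x = r * layerFlux κ z A B x := by
  simp only [layerFlux]
  ring

/-- Divide by A_1 and set the irrelevant coefficients to 0. -/
theorem IsMatched.exists_isLayerCoeff (hm : 1 ≤ m) (hγ : ∀ j ∈ Finset.Icc 1 m, 0 < γ j)
    (h : IsMatched m γ b z A B) (hA : A 1 ≠ 0) (hB : B m = 0) :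
    ∃ A' B' : ℕ → ℂ, IsLayerCoeff m γ b z A' B' := by
  have hm1 : 1 ∈ Finset.Icc 1 m := Finset.mem_Icc.2 ⟨le_rfl, hm⟩
  have hin : ∀ j ∈ Finset.Ico 1 m, j ∈ Finset.Icc 1 m ∧ j + 1 ∈ Finset.Icc 1 m := fun j hj => by
    rw [Finset.mem_Ico] at hj
    exact ⟨Finset.mem_Icc.2 ⟨hj.1, hj.2.le⟩, Finset.mem_Icc.2 ⟨by omega, hj.2⟩⟩
  refine ⟨fun j => if j ∈ Finset.Icc 1 m then (A 1)⁻¹ * A j else 0,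
    fun j => if j ∈ Finset.Icc 1 m then (A 1)⁻¹ * B j else 0, ?_, ?_, ?_, ?_, ?_⟩
  · simp only [if_pos hm1]
    exact inv_mul_cancel₀ hA
  · simp [hB]
  · intro j hj
    simp only [if_pos (hin j hj).1, if_pos (hin j hj).2, layerWave_mul_left, h.wave j hj]
  · intro j hj
    simp only [if_pos (hin j hj).1, if_pos (hin j hj).2]
    rw [mul_deriv_layerWave (hγ _ (hin j hj).1), mul_deriv_layerWave (hγ _ (hin j hj).2),
      layerFlux_mul_left, layerFlux_mul_left, h.flux j hj]
  · intro j hj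
    simp only [if_neg hj, and_self]

end Algebra

/-! ### Normalized coefficients and their limits -/

/-- Travel time from `b_j` to `b_m`. -/
noncomputable def tailTime (m : ℕ) (γ b : ℕ → ℝ) (j : ℕ) : ℝ :=
  ∑ k ∈ Finset.Ico j m, (b (k + 1) - b k) / Real.sqrt (γ (k + 1))

theorem tailTime_self (m : ℕ) (γ b : ℕ → ℝ) : tailTime m γ b m = 0 := by simp [tailTime]

theorem tailTime_eq_add {m : ℕ} (γ b : ℕ → ℝ) {j : ℕ} (hj : j < m) :
    tailTime m γ b j = (b (j + 1) - b j) / Real.sqrt (γ (j + 1)) + tailTime m γ b (j + 1) :=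
  Finset.sum_eq_sum_Ico_succ_bot hj _

theorem tailTime_zero {m : ℕ} (hm : 1 ≤ m) {γ b : ℕ → ℝ} (hb0 : b 0 = 0) :
    tailTime m γ b 0 = travelTime m γ b := by
  rw [tailTime_eq_add γ b hm, hb0, sub_zero]
  rfl

theorem tailTime_anti {m : ℕ} {γ b : ℕ → ℝ} (hb : ∀ j < m, b j < b (j + 1)) {i j : ℕ}
    (hij : i ≤ j) : tailTime m γ b j ≤ tailTime m γ b i := by
  refine Finset.sum_le_sum_of_subset_of_nonneg (Finset.Ico_subset_Ico_left hij) fun k hk _ => ?_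
  exact div_nonneg (sub_nonneg.2 (hb k (Finset.mem_Ico.1 hk).2).le) (Real.sqrt_nonneg _)

/-- Amplitude at `b_j` of the term `A e^{x z_j}`, multiplied by `e^{z s}`, where `s` is the travel
time from `b_j` to `b_m`. -/
noncomputable def normA (m : ℕ) (γ b : ℕ → ℝ) (z : ℂ) (A : ℕ → ℂ) (j : ℕ) : ℂ :=
  A j * Complex.exp ((b j : ℂ) * (z / (Real.sqrt (γ j) : ℂ))) *
    Complex.exp (z * tailTime m γ b j)

/-- Amplitude at `b_j` of the term `B e^{-x z_j}`, multiplied by `e^{z s}`, where `s` is the travel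
time from `b_j` to `b_m`. -/
noncomputable def normB (m : ℕ) (γ b : ℕ → ℝ) (z : ℂ) (B : ℕ → ℂ) (j : ℕ) : ℂ :=
  B j * Complex.exp (-((b j : ℂ) * (z / (Real.sqrt (γ j) : ℂ)))) *
    Complex.exp (z * tailTime m γ b j)

/-- Factor `e^{2 z s}`, where `s` is the travel time through the `(j+1)`-st layer. -/
noncomputable def roundTrip (γ b : ℕ → ℝ) (z : ℂ) (j : ℕ) : ℂ :=
  Complex.exp (2 * z * ((b (j + 1) - b j) / Real.sqrt (γ (j + 1)) : ℝ))

section Normalized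

variable {m : ℕ} {γ b : ℕ → ℝ} {z : ℂ} {A B : ℕ → ℂ}

theorem mul_exp_left_end_A {j : ℕ} (hj : j < m) :
    A (j + 1) * Complex.exp ((b j : ℂ) * (z / (Real.sqrt (γ (j + 1)) : ℂ))) *
      Complex.exp (z * tailTime m γ b j) = normA m γ b z A (j + 1) := by
  rw [normA, tailTime_eq_add γ b hj, mul_assoc, mul_assoc, ← Complex.exp_add, ← Complex.exp_add]
  congr 2
  push_cast
  ring

/-- Crossing a layer leftwards leaves the normalized A-term unchanged, but the B-term moves against
the normalization and picks up the round-trip factor. -/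
theorem mul_exp_left_end_B {j : ℕ} (hj : j < m) :
    B (j + 1) * Complex.exp (-((b j : ℂ) * (z / (Real.sqrt (γ (j + 1)) : ℂ)))) *
      Complex.exp (z * tailTime m γ b j) = normB m γ b z B (j + 1) * roundTrip γ b z j := by
  rw [normB, roundTrip, tailTime_eq_add γ b hj]
  simp only [mul_assoc]
  rw [← Complex.exp_add, ← Complex.exp_add, ← Complex.exp_add]
  congr 2
  push_cast
  ring

theorem layerWave_left_end {j : ℕ} (hj : j < m) :
    layerWave (γ (j + 1)) z (A (j + 1)) (B (j + 1)) (b j) * Complex.exp (z * tailTime m γ b j) =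
      normA m γ b z A (j + 1) + normB m γ b z B (j + 1) * roundTrip γ b z j := by
  rw [layerWave, add_mul, mul_exp_left_end_A hj, mul_exp_left_end_B hj]

theorem layerFlux_left_end {j : ℕ} (hj : j < m) :
    layerFlux (γ (j + 1)) z (A (j + 1)) (B (j + 1)) (b j) * Complex.exp (z * tailTime m γ b j) =
      Real.sqrt (γ (j + 1)) *
        (normA m γ b z A (j + 1) - normB m γ b z B (j + 1) * roundTrip γ b z j) := by
  rw [layerFlux, mul_assoc, sub_mul, mul_exp_left_end_A hj, mul_exp_left_end_B hj]

/-- Transmission through one interface: continuity gives the sum of the two amplitudes on the left,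
flux continuity their difference. -/
theorem IsMatched.norm_rec (hγ : ∀ j ∈ Finset.Icc 1 m, 0 < γ j) (h : IsMatched m γ b z A B)
    {j : ℕ} (hj : j ∈ Finset.Ico 1 m) :
    normA m γ b z A j =
        (1 + (Real.sqrt (γ (j + 1)) / Real.sqrt (γ j) : ℝ)) / 2 * normA m γ b z A (j + 1) +
        (1 - (Real.sqrt (γ (j + 1)) / Real.sqrt (γ j) : ℝ)) / 2 *
          (normB m γ b z B (j + 1) * roundTrip γ b z j) ∧
      normB m γ b z B j =
        (1 - (Real.sqrt (γ (j + 1)) / Real.sqrt (γ j) : ℝ)) / 2 * normA m γ b z A (j + 1) +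
        (1 + (Real.sqrt (γ (j + 1)) / Real.sqrt (γ j) : ℝ)) / 2 *
          (normB m γ b z B (j + 1) * roundTrip γ b z j) := by
  have hj' := Finset.mem_Ico.1 hj
  have hs := sqrt_ne_zero_of_mem hγ (Finset.mem_Icc.2 ⟨hj'.1, hj'.2.le⟩)
  have e1 := layerWave_left_end (γ := γ) (b := b) (z := z) (A := A) (B := B) hj'.2
  have e2 := layerFlux_left_end (γ := γ) (b := b) (z := z) (A := A) (B := B) hj'.2
  rw [← h.wave j hj, layerWave, add_mul] at e1
  rw [← h.flux j hj, layerFlux, mul_assoc, sub_mul] at e2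
  change normA m γ b z A j + normB m γ b z B j = _ at e1
  change (Real.sqrt (γ j) : ℂ) * (normA m γ b z A j - normB m γ b z B j) = _ at e2
  have e3 : normA m γ b z A j - normB m γ b z B j =
      ((Real.sqrt (γ (j + 1)) / Real.sqrt (γ j) : ℝ) : ℂ) *
        (normA m γ b z A (j + 1) - normB m γ b z B (j + 1) * roundTrip γ b z j) := by
    refine mul_left_cancel₀ hs (e2.trans ?_)
    push_cast
    field_simp
  constructor
  · linear_combination (1 / 2 : ℂ) * e1 + (1 / 2 : ℂ) * e3
  · linear_combination (1 / 2 : ℂ) * e1 - (1 / 2 : ℂ) * e3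

end Normalized

section Limits

variable {m : ℕ} {γ b : ℕ → ℝ} {ι : Type*} {l : Filter ι} {z : ι → ℂ} {A B : ι → ℕ → ℂ}

theorem tendsto_roundTrip (hγ : ∀ j ∈ Finset.Icc 1 m, 0 < γ j)
    (hb : ∀ j < m, b j < b (j + 1)) (hz : Tendsto (fun i => (z i).re) l atBot) {j : ℕ}
    (hj : j < m) : Tendsto (fun i => roundTrip γ b (z i) j) l (𝓝 0) := by
  have hd : 0 < (b (j + 1) - b j) / Real.sqrt (γ (j + 1)) :=
    div_pos (sub_pos.2 (hb j hj)) (Real.sqrt_pos.2 (hγ _ (Finset.mem_Icc.2 ⟨by omega, hj⟩)))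
  refine Complex.tendsto_exp_comap_re_atBot.comp (tendsto_comap_iff.2 ?_)
  have : (Complex.re ∘ fun i => 2 * z i * (((b (j + 1) - b j) / Real.sqrt (γ (j + 1)) : ℝ) : ℂ)) =
      fun i => (z i).re * (2 * ((b (j + 1) - b j) / Real.sqrt (γ (j + 1)))) := by
    funext i
    rw [Function.comp, Complex.re_mul_ofReal, two_mul, Complex.add_re]
    ring
  rw [this]
  exact hz.atBot_mul_const (by positivity)

/-- Since Re z → -∞, the round-trip factors kill the B-contributions. The A-limit is multiplied at
each step by (1 + r)/2 > 0, so it never vanishes; the B-limit stays finite but its sign is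
uncontrolled. -/
theorem exists_tendsto_norm (hγ : ∀ j ∈ Finset.Icc 1 m, 0 < γ j)
    (hb : ∀ j < m, b j < b (j + 1)) (hz : Tendsto (fun i => (z i).re) l atBot)
    (h : ∀ i, IsMatched m γ b (z i) (A i) (B i)) {p q : ℝ} (hp : 0 < p)
    (hA : Tendsto (fun i => normA m γ b (z i) (A i) m) l (𝓝 (p : ℂ)))
    (hB : Tendsto (fun i => normB m γ b (z i) (B i) m) l (𝓝 (q : ℂ))) {j : ℕ} (h1 : 1 ≤ j)
    (hj : j ≤ m) : ∃ p q : ℝ, 0 < p ∧ Tendsto (fun i => normA m γ b (z i) (A i) j) l (𝓝 (p : ℂ)) ∧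
      Tendsto (fun i => normB m γ b (z i) (B i) j) l (𝓝 (q : ℂ)) := by
  induction hj using Nat.decreasingInduction with
  | self => exact ⟨p, q, hp, hA, hB⟩
  | of_succ k hk ih =>
    obtain ⟨p, q, hp, hA, hB⟩ := ih (by omega)
    have hE := tendsto_roundTrip hγ hb hz hk
    have hk' : k ∈ Finset.Ico 1 m := Finset.mem_Ico.2 ⟨h1, hk⟩
    set r : ℝ := Real.sqrt (γ (k + 1)) / Real.sqrt (γ k) with hr
    have hr0 : 0 ≤ r := div_nonneg (Real.sqrt_nonneg _) (Real.sqrt_nonneg _)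
    have hBE := hB.mul hE
    rw [mul_zero] at hBE
    refine ⟨(1 + r) / 2 * p, (1 - r) / 2 * p, by positivity, ?_, ?_⟩
    · simp only [fun i => ((h i).norm_rec hγ hk').1, ← hr]
      have := (hA.const_mul ((1 + (r : ℂ)) / 2)).add (hBE.const_mul ((1 - (r : ℂ)) / 2))
      rw [mul_zero, add_zero] at this
      exact_mod_cast this
    · simp only [fun i => ((h i).norm_rec hγ hk').2, ← hr]
      have := (hA.const_mul ((1 - (r : ℂ)) / 2)).add (hBE.const_mul ((1 + (r : ℂ)) / 2))
      rw [mul_zero, add_zero] at this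
      exact_mod_cast this

end Limits

/-- Uniformly in x, the wave is at most of order |e^{-zℓ}|: relative to the normalized amplitudes,
the remaining exponents are z times a nonnegative travel time. -/
theorem norm_gluedWave_mul_exp_le {m : ℕ} {γ b : ℕ → ℝ} (hm : 1 ≤ m)
    (hγ : ∀ j ∈ Finset.Icc 1 m, 0 < γ j) (hb : ∀ j < m, b j < b (j + 1)) {z : ℂ}
    (hz : z.re ≤ 0) (A B : ℕ → ℂ) {x : ℝ} (hx : x ∈ Icc (b 0) (b m)) :
    ‖gluedWave m γ b z A B x * Complex.exp (z * tailTime m γ b 0)‖ ≤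
      ∑ j ∈ Finset.Icc 1 m, (‖normA m γ b z A j‖ + ‖normB m γ b z B j‖) := by
  have hi := layerIndex_mem (b := b) hm x
  have hx' := mem_Icc_layerIndex hb hm hx
  refine le_trans ?_ (Finset.single_le_sum
    (f := fun j => ‖normA m γ b z A j‖ + ‖normB m γ b z B j‖)
    (fun j _ => by positivity) hi)
  rw [gluedWave, layerWave]
  generalize layerIndex m b x = j at hi hx' ⊢
  have hj := Finset.mem_Icc.1 hi
  have hs := Real.sqrt_pos.2 (hγ j hi)
  have hd := tailTime_eq_add γ b (show j - 1 < m by omega)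
  rw [Nat.sub_add_cancel hj.1] at hd
  have hmono := tailTime_anti (γ := γ) hb (Nat.zero_le (j - 1))
  have hgap : (b j - x) / Real.sqrt (γ j) ≤ (b j - b (j - 1)) / Real.sqrt (γ j) :=
    div_le_div_of_nonneg_right (by linarith [hx'.1]) hs.le
  have hgap0 : 0 ≤ (b j - x) / Real.sqrt (γ j) := div_nonneg (by linarith [hx'.2]) hs.le
  have eA : A j * Complex.exp ((x : ℂ) * (z / (Real.sqrt (γ j) : ℂ))) *
      Complex.exp (z * tailTime m γ b 0) = normA m γ b z A j * Complex.exp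
        (z * ((tailTime m γ b 0 - tailTime m γ b j - (b j - x) / Real.sqrt (γ j) : ℝ) : ℂ)) := by
    rw [normA, mul_assoc, mul_assoc, mul_assoc, ← Complex.exp_add, ← Complex.exp_add,
      ← Complex.exp_add]
    congr 2
    push_cast
    ring
  have eB : B j * Complex.exp (-((x : ℂ) * (z / (Real.sqrt (γ j) : ℂ)))) *
      Complex.exp (z * tailTime m γ b 0) = normB m γ b z B j * Complex.exp
        (z * ((tailTime m γ b 0 - tailTime m γ b j + (b j - x) / Real.sqrt (γ j) : ℝ) : ℂ)) := by
    rw [normB, mul_assoc, mul_assoc, mul_assoc, ← Complex.exp_add, ← Complex.exp_add,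
      ← Complex.exp_add]
    congr 2
    push_cast
    ring
  have hle : ∀ r : ℝ, 0 ≤ r → ‖Complex.exp (z * (r : ℂ))‖ ≤ 1 := fun r hr => by
    rw [Complex.norm_exp, Complex.re_mul_ofReal, Real.exp_le_one_iff]
    exact mul_nonpos_of_nonpos_of_nonneg hz hr
  rw [add_mul, eA, eB]
  refine (norm_add_le _ _).trans (add_le_add ?_ ?_)
  · rw [norm_mul]
    exact mul_le_of_le_one_right (norm_nonneg _) (hle _ (by linarith))
  · rw [norm_mul]
    exact mul_le_of_le_one_right (norm_nonneg _) (hle _ (by linarith))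

end LayeredHeat

namespace LayeredHeat

open Asymptotics

/-! ### Logarithmic asymptotics -/

/-- The main term has size e^{-rτ} up to constants and powers of τ, whose logarithms are o(τ); the
error is exponentially smaller because r < σ. -/
theorem tendsto_log_norm_div_of_isBigO {I G k w : ℝ → ℂ} {k₀ : ℂ} (hk₀ : k₀ ≠ 0)
    (hk : Tendsto k atTop (𝓝 k₀)) {r σ C μ K : ℝ} (hC : 0 < C) (hrσ : r < σ)
    (hw : ∀ τ, ‖w τ‖ = Real.exp (-r * τ)) (hGK : ∀ᶠ τ in atTop, ‖G τ‖ ≤ K)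
    (hG : ∀ᶠ τ in atTop, C * τ ^ μ ≤ ‖G τ‖)
    (hI : (fun τ => I τ - k τ * w τ * G τ) =O[atTop] fun τ : ℝ => τ * Real.exp (-σ * τ)) :
    Tendsto (fun τ => Real.log ‖I τ‖ / τ) atTop (𝓝 (-r)) := by
  obtain ⟨K', hK'⟩ := hI.bound
  have hn : 0 < ‖k₀‖ := norm_pos_iff.2 hk₀
  have hε : 0 < σ - r := sub_pos.2 hrσ
  -- The exponent 1 - μ comes from comparing the error τ e^{-(σ-r)τ} with the lower bound τ^μ.
  have hlow := (tendsto_rpow_mul_exp_neg_mul_atTop_nhds_zero (1 - μ) _ hε).const_mul K'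
  have hupp := (tendsto_rpow_mul_exp_neg_mul_atTop_nhds_zero 1 _ hε).const_mul K'
  rw [mul_zero] at hlow hupp
  -- Eventually |k| ≥ |k₀|/2, and the error takes at most half of what this leaves. In the upper
  -- constant below, the +1 absorbs the error.
  have hc₁ : 0 < ‖k₀‖ / 4 * C := by positivity
  have hK₂ : 0 < 2 * ‖k₀‖ * |K| + 1 := by positivity
  have hL : ∀ᶠ τ in atTop, -r + (Real.log (‖k₀‖ / 4 * C) / τ + μ * (Real.log τ / τ)) ≤
      Real.log ‖I τ‖ / τ ∧
      Real.log ‖I τ‖ / τ ≤ -r + Real.log (2 * ‖k₀‖ * |K| + 1) / τ := by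
    filter_upwards [hK', hGK, hG, hlow.eventually (gt_mem_nhds hc₁),
      hupp.eventually (gt_mem_nhds one_pos), eventually_gt_atTop 0,
      hk.norm.eventually (lt_mem_nhds (by linarith : ‖k₀‖ / 2 < ‖k₀‖)),
      hk.norm.eventually (gt_mem_nhds (by linarith : ‖k₀‖ < 2 * ‖k₀‖))]
      with τ h1 h2 h3 h4 h5 h6 h7 h8
    have hE : 0 < Real.exp (-r * τ) := Real.exp_pos _
    have hτμ : 0 < τ ^ μ := Real.rpow_pos_of_pos h6 μ
    have hexp : Real.exp (-σ * τ) = Real.exp (-r * τ) * Real.exp (-(σ - r) * τ) := by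
      rw [← Real.exp_add]
      ring_nf
    rw [norm_mul, Real.norm_of_nonneg h6.le, Real.norm_of_nonneg (Real.exp_pos _).le, hexp] at h1
    rw [Real.rpow_one] at h5
    have h4' : K' * (τ * Real.exp (-(σ - r) * τ)) ≤ ‖k₀‖ / 4 * C * τ ^ μ := by
      rw [Real.rpow_sub h6, Real.rpow_one] at h4
      have := mul_le_mul_of_nonneg_right h4.le hτμ.le
      refine le_trans (le_of_eq ?_) this
      field_simp
    have hmain : ‖k τ * w τ * G τ‖ = Real.exp (-r * τ) * (‖k τ‖ * ‖G τ‖) := by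
      rw [norm_mul, norm_mul, hw]
      ring
    have hup : ‖I τ‖ ≤ Real.exp (-r * τ) * (2 * ‖k₀‖ * |K| + 1) := by
      have ha : ‖I τ‖ ≤ ‖k τ * w τ * G τ‖ + ‖I τ - k τ * w τ * G τ‖ := by
        simpa using norm_add_le (k τ * w τ * G τ) (I τ - k τ * w τ * G τ)
      have hb : ‖k τ‖ * ‖G τ‖ ≤ 2 * ‖k₀‖ * |K| :=
        mul_le_mul h8.le (h2.trans (le_abs_self _)) (norm_nonneg _) (by positivity)
      rw [hmain] at ha
      nlinarith
    have hlo : Real.exp (-r * τ) * (‖k₀‖ / 4 * C * τ ^ μ) ≤ ‖I τ‖ := by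
      have ha : ‖k τ * w τ * G τ‖ ≤ ‖I τ‖ + ‖I τ - k τ * w τ * G τ‖ := by
        have := norm_sub_le (I τ) (I τ - k τ * w τ * G τ)
        rwa [sub_sub_cancel] at this
      have hb : ‖k₀‖ / 2 * (C * τ ^ μ) ≤ ‖k τ‖ * ‖G τ‖ :=
        mul_le_mul h7.le h3 (by positivity) (norm_nonneg _)
      rw [hmain] at ha
      nlinarith
    have hpos : 0 < ‖I τ‖ := lt_of_lt_of_le (by positivity) hlo
    have l1 := Real.log_le_log (by positivity) hlo
    have l2 := Real.log_le_log hpos hup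
    rw [Real.log_mul hE.ne' (by positivity), Real.log_exp, Real.log_mul hc₁.ne' hτμ.ne',
      Real.log_rpow h6] at l1
    rw [Real.log_mul hE.ne' hK₂.ne', Real.log_exp] at l2
    constructor
    · rw [le_div_iff₀ h6]
      refine le_trans (le_of_eq ?_) l1
      field_simp
    · rw [div_le_iff₀ h6]
      refine l2.trans (le_of_eq ?_)
      field_simp
  have hlog : Tendsto (fun τ : ℝ => Real.log τ / τ) atTop (𝓝 0) :=
    Real.isLittleO_log_id_atTop.tendsto_div_nhds_zero
  have hinv : ∀ s : ℝ, Tendsto (fun τ : ℝ => s / τ) atTop (𝓝 0) := fun s =>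
    tendsto_const_nhds.div_atTop tendsto_id
  refine tendsto_of_tendsto_of_tendsto_of_le_of_le' ?_ ?_ (hL.mono fun _ h => h.1)
    (hL.mono fun _ h => h.2)
  · simpa using ((hinv (Real.log (‖k₀‖ / 4 * C))).add (hlog.const_mul μ)).const_add (-r)
  · simpa using (hinv (Real.log (2 * ‖k₀‖ * |K| + 1))).const_add (-r)

/-! ### The spectral parameter -/

theorem zc_re (c τ : ℝ) : (zc c τ).re = -(c * τ) := by
  simp [zc]

/-- With s the square root in z, Re z² = c²τ²(1 - s²), and s² = 1 - 1/(c²τ) makes this τ. The bound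
on τ keeps the radicand nonnegative. -/
theorem neg_zc_sq_re {c τ : ℝ} (hc : 0 < c) (hτ : 1 / c ^ 2 ≤ τ) : (-(zc c τ) ^ 2).re = -τ := by
  have hτ0 : 0 < τ := lt_of_lt_of_le (by positivity) hτ
  have h1 : 1 / (c ^ 2 * τ) ≤ 1 := by
    rw [div_le_one (by positivity)]
    rwa [div_le_iff₀ (by positivity), mul_comm] at hτ
  have hs := Real.sq_sqrt (sub_nonneg.2 h1)
  have h2 : (-(zc c τ) ^ 2).re = -((c * τ) ^ 2 * (1 - Real.sqrt (1 - 1 / (c ^ 2 * τ)) ^ 2)) := by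
    simp [zc, sq]
    ring
  rw [h2, hs]
  field_simp
  ring

theorem norm_zc_le {c τ : ℝ} (hc : 0 < c) (hτ : 0 < τ) : ‖zc c τ‖ ≤ 2 * c * τ := by
  have hs : Real.sqrt (1 - 1 / (c ^ 2 * τ)) ≤ 1 :=
    Real.sqrt_le_one.2 (by have : 0 < 1 / (c ^ 2 * τ) := by positivity
                           linarith)
  have h : ‖1 + Complex.I * (Real.sqrt (1 - 1 / (c ^ 2 * τ)) : ℂ)‖ ≤ 2 := by
    refine (norm_add_le _ _).trans ?_
    rw [norm_one, norm_mul, Complex.norm_I, one_mul, Complex.norm_real,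
      Real.norm_of_nonneg (Real.sqrt_nonneg _)]
    linarith
  rw [zc, norm_mul, norm_neg, norm_mul, Complex.norm_real, Complex.norm_real,
    Real.norm_of_nonneg hc.le, Real.norm_of_nonneg hτ.le]
  nlinarith [mul_pos hc hτ]

theorem tendsto_zc_re {c : ℝ} (hc : 0 < c) : Tendsto (fun τ => (zc c τ).re) atTop atBot := by
  simp only [zc_re]
  exact tendsto_neg_atTop_atBot.comp (tendsto_id.const_mul_atTop hc)

theorem tendsto_zc_inv {c : ℝ} (hc : 0 < c) : Tendsto (fun τ => (zc c τ)⁻¹) atTop (𝓝 0) := by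
  refine tendsto_inv₀_cobounded.comp (tendsto_norm_atTop_iff_cobounded.1 ?_)
  refine tendsto_atTop_mono (fun τ => ?_) (tendsto_id.const_mul_atTop hc)
  have := Complex.abs_re_le_norm (zc c τ)
  rw [zc_re, abs_neg] at this
  exact (le_abs_self _).trans this

theorem zc_ne_zero {c τ : ℝ} (hc : 0 < c) (hτ : 0 < τ) : zc c τ ≠ 0 := by
  intro h
  have := zc_re c τ
  rw [h, Complex.zero_re] at this
  nlinarith [mul_pos hc hτ]

theorem norm_exp_neg_zc_sq_mul {c τ : ℝ} (hc : 0 < c) (hτ : 1 / c ^ 2 ≤ τ) (t : ℝ) :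
    ‖Complex.exp (-(zc c τ) ^ 2 * (t : ℂ))‖ = Real.exp (-τ * t) := by
  rw [Complex.norm_exp, Complex.re_mul_ofReal, neg_zc_sq_re hc hτ]

/-! ### Remainder estimates -/

theorem norm_integral_mul_le {T L : ℝ} (hT : 0 ≤ T) {F w : ℝ → ℂ}
    (hF : IntervalIntegrable F volume 0 T) (hw : ∀ t ∈ Icc 0 T, ‖w t‖ ≤ L) :
    ‖∫ t in (0 : ℝ)..T, F t * w t‖ ≤ L * ∫ t in (0 : ℝ)..T, ‖F t‖ := by
  rw [← intervalIntegral.integral_const_mul]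
  refine intervalIntegral.norm_integral_le_of_norm_le hT (ae_of_all _ fun t ht => ?_)
    (hF.norm.const_mul L)
  rw [norm_mul, mul_comm]
  exact mul_le_mul_of_nonneg_right (hw t (Ioc_subset_Icc_self ht)) (norm_nonneg _)

/-- The constant is the L¹ norm of f and does not depend on the weight, which will be a wave varying
with τ. -/
theorem exists_integral_norm_moment_le {a T : ℝ} (ha : 0 ≤ a) (hT : 0 ≤ T) {f : ℝ → ℝ → ℂ}
    (hf : MemLp (fun p : ℝ × ℝ => f p.1 p.2) 2 (volume.restrict (Ioo 0 a ×ˢ Ioo 0 T))) :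
    ∃ D, ∀ (w : ℝ → ℂ) (N : ℝ), Measurable w → (∀ x ∈ Icc 0 a, ‖w x‖ ≤ N) →
      ∫ t in (0 : ℝ)..T, ‖∫ x in (0 : ℝ)..a, f x t * w x‖ ≤ N * D := by
  have : IsFiniteMeasure ((volume : Measure (ℝ × ℝ)).restrict (Ioo 0 a ×ˢ Ioo 0 T)) := by
    refine ⟨?_⟩
    rw [Measure.restrict_apply_univ, Measure.volume_eq_prod, Measure.prod_prod]
    simp [Real.volume_Ioo, ENNReal.mul_lt_top]
  have h1 : Integrable (fun p : ℝ × ℝ => ‖f p.1 p.2‖)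
      (volume.restrict (Ioo 0 a ×ˢ Ioo 0 T)) := (hf.integrable (by norm_num)).norm
  rw [Measure.volume_eq_prod, ← Measure.prod_restrict] at h1
  refine ⟨∫ t in Ioo 0 T, ∫ x in Ioo 0 a, ‖f x t‖, fun w N hw hN => ?_⟩
  have hint := intervalIntegrable_integral_mul ha hT hf hw hN
  rw [intervalIntegrable_iff_integrableOn_Ioc_of_le hT,
    integrableOn_Ioc_iff_integrableOn_Ioo] at hint
  rw [intervalIntegral.integral_of_le hT, integral_Ioc_eq_integral_Ioo, ← integral_const_mul]
  refine integral_mono_ae hint.norm (h1.integral_prod_right.const_mul N) ?_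
  filter_upwards [h1.prod_left_ae] with t ht
  change ‖∫ x in (0 : ℝ)..a, f x t * w x‖ ≤ N * ∫ x in Ioo 0 a, ‖f x t‖
  rw [intervalIntegral.integral_of_le ha, integral_Ioc_eq_integral_Ioo, ← integral_const_mul]
  refine norm_integral_le_of_norm_le (ht.const_mul N) ?_
  filter_upwards [ae_restrict_mem measurableSet_Ioo] with x hx
  rw [norm_mul, mul_comm]
  exact mul_le_mul_of_nonneg_right (hN x (Ioo_subset_Icc_self hx)) (norm_nonneg _)

/-- Admissible test functions vanish near T; this cutoff reaches 0 at the midpoint of σ and T and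
alters nothing before σ. -/
theorem exists_smooth_cutoff {σ T : ℝ} (hσ : σ < T) :
    ∃ χ : ℝ → ℝ, ContDiff ℝ ∞ χ ∧ (∃ s < T, ∀ t, s ≤ t → χ t = 0) ∧ (∀ t ≤ σ, χ t = 1) ∧
      (∀ t, χ t ∈ Icc (0 : ℝ) 1) := by
  have hd : 0 < (σ + T) / 2 - σ := by linarith
  refine ⟨fun t => Real.smoothTransition (((σ + T) / 2 - t) / ((σ + T) / 2 - σ)), ?_,
    ⟨(σ + T) / 2, by linarith, fun t ht => ?_⟩, fun t ht => ?_,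
    fun t => ⟨Real.smoothTransition.nonneg _, Real.smoothTransition.le_one _⟩⟩
  · exact Real.smoothTransition.contDiff.comp ((contDiff_const.sub contDiff_id).div_const _)
  · exact Real.smoothTransition.zero_of_nonpos (div_nonpos_of_nonpos_of_nonneg (by linarith) hd.le)
  · exact Real.smoothTransition.one_of_one_le ((one_le_div hd).2 (by linarith))

end LayeredHeat

namespace LayeredHeat

open Asymptotics

/-- On t ≥ σ, where ψ can be nonzero, the weight e^{-τt} is at most e^{-στ}. -/
theorem norm_exp_neg_zc_sq_mul_le {c τ σ T K : ℝ} (hc : 0 < c) (hτ : 1 / c ^ 2 ≤ τ) (hK : 0 ≤ K)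
    {ψ : ℝ → ℂ} (hψ0 : ∀ t < σ, ψ t = 0) (hψ : ∀ t ∈ Icc 0 T, ‖ψ t‖ ≤ K) :
    ∀ t ∈ Icc 0 T, ‖Complex.exp (-(zc c τ) ^ 2 * (t : ℂ)) * ψ t‖ ≤ K * Real.exp (-σ * τ) := by
  intro t ht
  have hτ0 : 0 < τ := lt_of_lt_of_le (by positivity) hτ
  rcases lt_or_ge t σ with h | h
  · rw [hψ0 t h, mul_zero, norm_zero]
    positivity
  · rw [norm_mul, norm_exp_neg_zc_sq_mul hc hτ, mul_comm]
    refine mul_le_mul (hψ t ht) (Real.exp_le_exp.2 ?_) (Real.exp_pos _).le hK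
    nlinarith

/-! ### The indicator function -/

theorem IsHeatSolution.intervalIntegrable_trace {m : ℕ} {γ b : ℕ → ℝ} {ρ T : ℝ}
    {u : ℝ → ℝ → ℂ} {g : ℝ → ℂ} (hu : IsHeatSolution m γ b ρ T u g) (ha : 0 < b m) (hT : 0 ≤ T) :
    IntervalIntegrable (fun t => u 0 t) volume 0 T := by
  obtain ⟨ux, hux, -⟩ := hu.weak
  exact hux.intervalIntegrable_trace_left ha hT

theorem IsHeatSolution.intervalIntegrable_flux {m : ℕ} {γ b : ℕ → ℝ} {ρ T : ℝ}
    {u : ℝ → ℝ → ℂ} {g : ℝ → ℂ} (hu : IsHeatSolution m γ b ρ T u g) (hT : 0 ≤ T) :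
    IntervalIntegrable g volume 0 T := by
  rw [intervalIntegrable_iff_integrableOn_Ioc_of_le hT, integrableOn_Ioc_iff_integrableOn_Ioo]
  exact hu.flux_memLp.integrable (by norm_num)

theorem indicatorFn_eq {m : ℕ} (hm : 1 ≤ m) {γ b : ℕ → ℝ}
    (hγ : ∀ j ∈ Finset.Icc 1 m, 0 < γ j) (hb0 : b 0 = 0) (hb : ∀ j < m, b j < b (j + 1))
    {T c τ : ℝ} {u : ℝ → ℝ → ℂ} {g : ℝ → ℂ}
    (hu0 : IntervalIntegrable (fun t => u 0 t) volume 0 T)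
    (hg : IntervalIntegrable g volume 0 T) (hz : zc c τ ≠ 0)
    {A B : ℕ → ℂ} (h : IsLayerCoeff m γ b (zc c τ) A B) :
    indicatorFn m γ b T u g c τ =
      -(zc c τ * (Real.sqrt (γ 1) * (1 - B 1))) *
        (∫ t in (0 : ℝ)..T, u 0 t * Complex.exp (-(zc c τ) ^ 2 * (t : ℂ))) +
      γ 1 * (1 + B 1) * (∫ t in (0 : ℝ)..T, g t * Complex.exp (-(zc c τ) ^ 2 * (t : ℂ))) := by
  set z := zc c τ with hzdef
  -- The chosen coefficients satisfy the specification because some coefficients do, and uniqueness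
  -- identifies them with the given ones.
  have hspec : IsLayerCoeff m γ b z (layerCoeff m γ b z).1 (layerCoeff m γ b z).2 :=
    Classical.epsilon_spec
      (p := fun p : (ℕ → ℂ) × (ℕ → ℂ) => IsLayerCoeff m γ b z p.1 p.2) ⟨(A, B), h⟩
  obtain ⟨hA, hB⟩ := hspec.unique hm hγ hz h
  have hb1 : 0 < b 1 := by simpa [hb0] using hb 0 (by omega)
  have hγ1 := hγ 1 (Finset.mem_Icc.2 ⟨le_rfl, hm⟩)
  have hPsi : ∀ x < b 1, Psi m γ b z x = layerWave (γ 1) z 1 (B 1) x := fun x hx => by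
    rw [Psi, conductivity, layerIndex_eq_one hb hm hx, hA, hB, h.first]
  have hexp : Continuous fun t : ℝ => Complex.exp (-z ^ 2 * (t : ℂ)) := by fun_prop
  have hderiv : ∀ t : ℝ, (γ 1 : ℂ) * deriv (fun x : ℝ => backwardHeat m γ b z x t) 0 =
      z * (Real.sqrt (γ 1) * (1 - B 1)) * Complex.exp (-z ^ 2 * (t : ℂ)) := fun t => by
    have hev : (fun x : ℝ => backwardHeat m γ b z x t) =ᶠ[𝓝 0]
        fun x => Complex.exp (-z ^ 2 * (t : ℂ)) * layerWave (γ 1) z 1 (B 1) x := by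
      filter_upwards [gt_mem_nhds hb1] with x hx
      rw [backwardHeat, hPsi x hx]
    rw [hev.deriv_eq, deriv_const_mul _ (hasDerivAt_layerWave hγ1 z 1 (B 1) 0).differentiableAt,
      mul_left_comm, mul_deriv_layerWave hγ1, layerFlux]
    simp only [Complex.ofReal_zero, zero_mul, neg_zero, Complex.exp_zero]
    ring
  have hval : ∀ t : ℝ, backwardHeat m γ b z 0 t = Complex.exp (-z ^ 2 * (t : ℂ)) * (1 + B 1) :=
    fun t => by
      rw [backwardHeat, hPsi 0 hb1, layerWave]
      simp
  rw [indicatorFn, ← hzdef, ← intervalIntegral.integral_const_mul,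
    ← intervalIntegral.integral_const_mul, ← intervalIntegral.integral_add]
  · refine intervalIntegral.integral_congr fun t _ => ?_
    simp only [hderiv, hval]
    ring
  · exact (hu0.mul_continuousOn hexp.continuousOn).const_mul _
  · exact (hg.mul_continuousOn hexp.continuousOn).const_mul _

/-- Elimination of the trace `u(0,·)` from the indicator function. -/
theorem indicator_sub_main_eq {I Iu Ig Iu' Ig' E₁ E₂ E₃ z κ κ' β B a b A' B' X γ : ℂ}
    (hI : I = -(z * (κ * (1 - B))) * Iu + γ * (1 + B) * Ig)
    (hIu : Iu = Iu' + E₁) (hIg : Ig = Ig' + E₂)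
    (htest : z * (κ * (A' - B')) * Iu' = γ * (A' + B') * Ig' - E₃)
    (hB : B * a = b) (hw : κ * (b * A' - a * B') = -(κ' * β)) (ha : a * X ≠ 0)
    (hR : κ * (A' - B') * X ≠ 0) :
    I - γ * (-(2 * (κ' * β)) / (a * X)) / (κ * (A' - B') * X) * (X * X) * Ig =
      (κ * (1 - B) * γ * ((A' + B') * X) * E₂ + κ * (1 - B) * (X * E₃) -
        z * (κ * (1 - B)) * (κ * (A' - B') * X) * E₁) * (κ * (A' - B') * X)⁻¹ := by
  -- The left side is the Wronskian of the special and the Robin wave at 0, which factors out X².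
  have hW : (1 + B) * (κ * (A' - B') * X) - κ * (1 - B) * ((A' + B') * X) =
      -(2 * (κ' * β)) / (a * X) * (X * X) := by
    have : ((1 + B) * (κ * (A' - B') * X) - κ * (1 - B) * ((A' + B') * X)) * (a * X) =
        -(2 * (κ' * β)) * (X * X) := by
      linear_combination 2 * (X * X) * hw + 2 * κ * A' * (X * X) * hB
    rw [div_mul_eq_mul_div, eq_div_iff ha, this]
  have hmain : I * (κ * (A' - B') * X) - γ * (-(2 * (κ' * β)) / (a * X)) * (X * X) * Ig =
      κ * (1 - B) * γ * ((A' + B') * X) * E₂ + κ * (1 - B) * (X * E₃) -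
        z * (κ * (1 - B)) * (κ * (A' - B') * X) * E₁ := by
    rw [mul_assoc γ, ← hW, hI, hIu, hIg]
    linear_combination (-(κ * (1 - B) * X)) * htest
  rw [← hmain]
  generalize κ * (A' - B') * X = R at hR ⊢
  generalize -(2 * (κ' * β)) / (a * X) = Q
  field_simp

/-- At 0 the full travel time is the normalization, and the B-term gains one more round trip through
the first layer, so only the A-term survives. -/
theorem tendsto_layerWave_zero_mul {m : ℕ} (hm : 1 ≤ m) {γ b : ℕ → ℝ}
    (hγ : ∀ j ∈ Finset.Icc 1 m, 0 < γ j) (hb0 : b 0 = 0) (hb : ∀ j < m, b j < b (j + 1))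
    {ι : Type*} {l : Filter ι} {z : ι → ℂ} {A B : ι → ℕ → ℂ}
    (hz : Tendsto (fun i => (z i).re) l atBot)
    (h : ∀ i, IsMatched m γ b (z i) (A i) (B i)) {p q : ℝ} (hp : 0 < p)
    (hA : Tendsto (fun i => normA m γ b (z i) (A i) m) l (𝓝 (p : ℂ)))
    (hB : Tendsto (fun i => normB m γ b (z i) (B i) m) l (𝓝 (q : ℂ))) :
    ∃ p : ℝ, 0 < p ∧
      Tendsto (fun i => A i 1 * Complex.exp (z i * travelTime m γ b)) l (𝓝 (p : ℂ)) ∧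
      Tendsto (fun i => B i 1 * Complex.exp (z i * travelTime m γ b)) l (𝓝 0) := by
  obtain ⟨p, q, hp, hA, hB⟩ := exists_tendsto_norm hγ hb hz h hp hA hB le_rfl hm
  refine ⟨p, hp, hA.congr fun i => ?_, ?_⟩
  · rw [← mul_exp_left_end_A hm, tailTime_zero hm hb0, hb0]
    simp
  · have := hB.mul (tendsto_roundTrip hγ hb hz hm)
    rw [mul_zero] at this
    refine this.congr fun i => ?_
    rw [← mul_exp_left_end_B hm, tailTime_zero hm hb0, hb0]
    simp

end LayeredHeat

/-! ### Proof of the theorem -/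

open LayeredHeat Asymptotics in
theorem theorem2p3 (m : ℕ) (hm : 1 ≤ m) (γ b : ℕ → ℝ)
    (hγ : ∀ j ∈ Finset.Icc 1 m, 0 < γ j)
    (hb0 : b 0 = 0) (hb : ∀ j < m, b j < b (j + 1))
    (ρ : ℝ) (hρ : 0 ≤ ρ) (T : ℝ) (u : ℝ → ℝ → ℂ) (g : ℝ → ℂ)
    (hu : LayeredHeat.IsHeatSolution m γ b ρ T u g)
    (M : ℝ) (hM : 0 < M) (hMt : 2 * LayeredHeat.travelTime m γ b ≤ M)
    (c : ℝ) (hc : 0 < c) (hMc : M * c < T)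
    (hflux : ∃ C : ℝ, 0 < C ∧ ∃ τ₀ : ℝ, (c ^ 2)⁻¹ < τ₀ ∧ ∃ μ : ℝ, ∀ τ : ℝ, τ₀ < τ →
      C * τ ^ μ ≤
        ‖∫ t in (0 : ℝ)..T, Complex.exp (-(LayeredHeat.zc c τ) ^ 2 * (t : ℂ)) * g t‖) :
    (∀ᶠ τ : ℝ in atTop, ∃! p : (ℕ → ℂ) × (ℕ → ℂ),
      LayeredHeat.IsLayerCoeff m γ b (LayeredHeat.zc c τ) p.1 p.2) ∧
    Tendsto (fun τ : ℝ => Real.log ‖LayeredHeat.indicatorFn m γ b T u g c τ‖ / τ) atTop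
      (𝓝 (-2 * c * LayeredHeat.travelTime m γ b)) := by
  have hT : 0 < T := (mul_pos hM hc).trans hMc
  have hm1 : 1 ∈ Finset.Icc 1 m := Finset.mem_Icc.2 ⟨le_rfl, hm⟩
  have hmm : m ∈ Finset.Icc 1 m := Finset.mem_Icc.2 ⟨hm, le_rfl⟩
  have hs1 := sqrt_ne_zero_of_mem hγ hm1
  have hsm := sqrt_ne_zero_of_mem hγ hmm
  have ha : 0 < b m := by
    have h1 : b 0 < b 1 := hb 0 (by omega)
    have h2 := le_of_forall_lt_succ hb hm le_rfl
    linarith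
  have hzre := tendsto_zc_re hc
  have hzinv := tendsto_zc_inv hc
  -- the wave decaying to the right of `b_m`
  choose a d had ham hdm using fun τ => exists_isMatched (b := b) hγ (zc c τ)
    (Complex.exp (-((b m : ℂ) * (zc c τ / (Real.sqrt (γ m) : ℂ))))) 0
  -- the wave with value `1` and flux `-ρ` at `b_m`
  choose A B hAB hAm hBm using fun τ => exists_isMatched (b := b) hγ (zc c τ)
    (Complex.exp (-((b m : ℂ) * (zc c τ / (Real.sqrt (γ m) : ℂ)))) *
      ((1 + -(ρ / zc c τ) / Real.sqrt (γ m)) / 2))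
    (Complex.exp ((b m : ℂ) * (zc c τ / (Real.sqrt (γ m) : ℂ))) *
      ((1 - -(ρ / zc c τ) / Real.sqrt (γ m)) / 2))
  have hee : ∀ τ, Complex.exp (-((b m : ℂ) * (zc c τ / (Real.sqrt (γ m) : ℂ)))) *
      Complex.exp ((b m : ℂ) * (zc c τ / (Real.sqrt (γ m) : ℂ))) = 1 := fun τ => by
    rw [← Complex.exp_add, neg_add_cancel, Complex.exp_zero]
  -- `layerFlux` carries a factor 1/z, so the Robin term is ρ/z and disappears in the limit: both
  -- amplitudes at b_m tend to 1/2.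
  have hρz : Tendsto (fun τ => -(ρ / zc c τ) / (Real.sqrt (γ m) : ℂ)) atTop (𝓝 0) := by
    have := ((hzinv.const_mul (ρ : ℂ)).neg).div_const (Real.sqrt (γ m) : ℂ)
    simpa [div_eq_mul_inv] using this
  have hβ : Tendsto (fun τ => (1 - -(ρ / zc c τ) / (Real.sqrt (γ m) : ℂ)) / 2) atTop
      (𝓝 ((1 / 2 : ℝ) : ℂ)) := by
    simpa using (hρz.const_sub 1).div_const 2
  have hα : Tendsto (fun τ => (1 + -(ρ / zc c τ) / (Real.sqrt (γ m) : ℂ)) / 2) atTop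
      (𝓝 ((1 / 2 : ℝ) : ℂ)) := by
    simpa using (hρz.const_add 1).div_const 2
  have hnAm : Tendsto (fun τ => normA m γ b (zc c τ) (A τ) m) atTop (𝓝 ((1 / 2 : ℝ) : ℂ)) :=
    hα.congr fun τ => by
      rw [normA, hAm, tailTime_self, Complex.ofReal_zero, mul_zero, Complex.exp_zero]
      linear_combination (-((1 + -(ρ / zc c τ) / (Real.sqrt (γ m) : ℂ)) / 2)) * hee τ
  have hnBm : Tendsto (fun τ => normB m γ b (zc c τ) (B τ) m) atTop (𝓝 ((1 / 2 : ℝ) : ℂ)) :=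
    hβ.congr fun τ => by
      rw [normB, hBm, tailTime_self, Complex.ofReal_zero, mul_zero, Complex.exp_zero]
      linear_combination (-((1 - -(ρ / zc c τ) / (Real.sqrt (γ m) : ℂ)) / 2)) * hee τ
  have hnam : Tendsto (fun τ => normA m γ b (zc c τ) (a τ) m) atTop (𝓝 ((1 : ℝ) : ℂ)) := by
    refine tendsto_const_nhds.congr fun τ => ?_
    rw [normA, ham, tailTime_self, Complex.ofReal_zero, mul_zero, Complex.exp_zero, hee]
    simp
  have hndm : Tendsto (fun τ => normB m γ b (zc c τ) (d τ) m) atTop (𝓝 ((0 : ℝ) : ℂ)) := by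
    refine tendsto_const_nhds.congr fun τ => ?_
    rw [normB, hdm]
    simp
  obtain ⟨p, hp, hapos, hd0⟩ :=
    tendsto_layerWave_zero_mul hm hγ hb0 hb hzre had one_pos hnam hndm
  obtain ⟨q, hq, hApos, hB0⟩ :=
    tendsto_layerWave_zero_mul hm hγ hb0 hb hzre hAB one_half_pos hnAm hnBm
  have hpC : (p : ℂ) ≠ 0 := by exact_mod_cast hp.ne'
  have hqC : (q : ℂ) ≠ 0 := by exact_mod_cast hq.ne'
  have haev : ∀ᶠ τ in atTop, a τ 1 * Complex.exp (zc c τ * travelTime m γ b) ≠ 0 :=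
    hapos.eventually_ne hpC
  have hR : Tendsto (fun τ => (Real.sqrt (γ 1) : ℂ) * (A τ 1 - B τ 1) *
      Complex.exp (zc c τ * travelTime m γ b)) atTop (𝓝 (Real.sqrt (γ 1) * q)) := by
    have := (hApos.sub hB0).const_mul (Real.sqrt (γ 1) : ℂ)
    rw [sub_zero] at this
    exact this.congr fun τ => by ring
  have hS : Tendsto (fun τ => (A τ 1 + B τ 1) * Complex.exp (zc c τ * travelTime m γ b))
      atTop (𝓝 q) := by
    have := hApos.add hB0
    rw [add_zero] at this
    exact this.congr fun τ => by ring
  have hRev := hR.eventually_ne (mul_ne_zero hs1 hqC)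
  have hex : ∀ᶠ τ in atTop, ∃ p : (ℕ → ℂ) × (ℕ → ℂ), IsLayerCoeff m γ b (zc c τ) p.1 p.2 := by
    filter_upwards [haev] with τ h1
    obtain ⟨A', B', h⟩ := (had τ).exists_isLayerCoeff hm hγ (left_ne_zero_of_mul h1) (hdm τ)
    exact ⟨(A', B'), h⟩
  refine ⟨?_, ?_⟩
  · filter_upwards [hex, eventually_gt_atTop 0] with τ ⟨p, hp⟩ hτ
    refine ⟨p, hp, fun r hr => ?_⟩
    obtain ⟨h1, h2⟩ := IsLayerCoeff.unique hm hγ (zc_ne_zero hc hτ) hr hp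
    exact Prod.ext h1 h2
  -- the reflection coefficient of the special solution
  have hr : Tendsto (fun τ => d τ 1 / a τ 1) atTop (𝓝 0) := by
    have := hd0.div hapos hpC
    rw [zero_div] at this
    refine this.congr fun τ => ?_
    exact mul_div_mul_right _ _ (Complex.exp_ne_zero _)
  obtain ⟨C, hC, τ₀, -, μ, hG⟩ := hflux
  have hu0 := hu.intervalIntegrable_trace ha hT.le
  have hg := hu.intervalIntegrable_flux hT.le
  obtain ⟨ux, hux, -⟩ := hu.weak
  -- Midway between Mc and T: errors of order e^{-στ} are then smaller than |X²| = e^{-2cℓτ}, as 2cℓ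
  -- ≤ Mc.
  set σ := (M * c + T) / 2 with hσ
  have hσT : σ < T := by rw [hσ]; linarith
  have hσM : M * c < σ := by rw [hσ]; linarith
  obtain ⟨χ, hχ, hχ0, hχ1, hχI⟩ := exists_smooth_cutoff hσT
  obtain ⟨s, hsT, hχs⟩ := hχ0
  obtain ⟨D, hD⟩ := exists_integral_norm_moment_le ha.le hT.le hux.memLp
  obtain ⟨K, hK⟩ := isCompact_Icc.exists_bound_of_continuousOn
    (hχ.continuous_deriv (by simp)).continuousOn (s := Icc 0 T)
  have hK0 : 0 ≤ K := (norm_nonneg _).trans (hK 0 ⟨le_rfl, hT.le⟩)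
  have hχd : ∀ t < σ, deriv χ t = 0 := fun t ht => by
    have : χ =ᶠ[𝓝 t] fun _ => 1 := by
      filter_upwards [gt_mem_nhds ht] with y hy using hχ1 y hy.le
    rw [this.deriv_eq, deriv_const]
  set X : ℝ → ℂ := fun τ => Complex.exp (zc c τ * travelTime m γ b) with hX
  set E : ℝ → ℝ → ℂ := fun τ t => Complex.exp (-(zc c τ) ^ 2 * (t : ℂ)) with hE
  have hEc : ∀ τ, ContDiff ℝ ∞ (E τ) := fun τ =>
    Complex.contDiff_exp.comp (contDiff_const.mul Complex.ofRealCLM.contDiff)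
  have hχc : ContDiff ℝ ∞ fun t => ((χ t : ℝ) : ℂ) := Complex.ofRealCLM.contDiff.comp hχ
  -- The error from differentiating the cutoff. The wave inside it may grow like 1/|X|, so only X E₃
  -- is bounded by e^{-στ}.
  set E₃ : ℝ → ℂ := fun τ => ∫ t in (0 : ℝ)..T,
    (∫ x in (0 : ℝ)..(b m), u x t * gluedWave m γ b (zc c τ) (A τ) (B τ) x) *
      (E τ t * deriv χ t) with hE₃
  have hτc : ∀ᶠ τ : ℝ in atTop, 1 / c ^ 2 ≤ τ := eventually_ge_atTop _
  have hcut : ∀ t ∈ Icc 0 T, ‖(1 - χ t : ℂ)‖ ≤ 1 := fun t _ => by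
    rw [← Complex.ofReal_one, ← Complex.ofReal_sub, Complex.norm_real,
      Real.norm_of_nonneg (sub_nonneg.2 (hχI t).2)]
    linarith [(hχI t).1]
  have hrem : ∀ {F : ℝ → ℂ}, IntervalIntegrable F volume 0 T →
      (fun τ => ∫ t in (0 : ℝ)..T, F t * (E τ t * (1 - χ t))) =O[atTop]
        fun τ : ℝ => Real.exp (-σ * τ) := fun {F} hF => by
    refine IsBigO.of_bound (∫ t in (0 : ℝ)..T, ‖F t‖) ?_
    filter_upwards [hτc] with τ hτ
    refine (norm_integral_mul_le hT.le hF (norm_exp_neg_zc_sq_mul_le hc hτ zero_le_one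
      (σ := σ) (fun t ht => ?_) hcut)).trans (le_of_eq ?_)
    · rw [hχ1 t ht.le]
      simp
    · rw [Real.norm_of_nonneg (Real.exp_pos _).le]
      ring
  have hE₁O := hrem hu0
  have hE₂O := hrem hg
  have hSum : (fun τ => ∑ j ∈ Finset.Icc 1 m, (‖normA m γ b (zc c τ) (A τ) j‖ +
      ‖normB m γ b (zc c τ) (B τ) j‖)) =O[atTop] fun _ => (1 : ℝ) := by
    refine IsBigO.fun_sum (A := fun j τ => ‖normA m γ b (zc c τ) (A τ) j‖ +
      ‖normB m γ b (zc c τ) (B τ) j‖) fun j hj => ?_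
    rw [Finset.mem_Icc] at hj
    obtain ⟨p, q, -, h1, h2⟩ :=
      exists_tendsto_norm hγ hb hzre hAB one_half_pos hnAm hnBm hj.1 hj.2
    exact (h1.norm.add h2.norm).isBigO_one ℝ
  have hE₃O : (fun τ => X τ * E₃ τ) =O[atTop] fun τ : ℝ => Real.exp (-σ * τ) := by
    have hSe := hSum.mul (isBigO_refl (fun τ : ℝ => Real.exp (-σ * τ)) atTop)
    simp only [one_mul] at hSe
    refine IsBigO.trans (IsBigO.of_bound (K * D) ?_) hSe
    filter_upwards [hτc] with τ hτ
    have hτ0 : 0 < τ := lt_of_lt_of_le (by positivity) hτ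
    have hXpos : 0 < ‖X τ‖ := norm_pos_iff.2 (Complex.exp_ne_zero _)
    have hwc := continuous_gluedWave hm hγ hb (hAB τ)
    have hsup : ∀ x ∈ Icc 0 (b m), ‖gluedWave m γ b (zc c τ) (A τ) (B τ) x‖ ≤
        (∑ j ∈ Finset.Icc 1 m, (‖normA m γ b (zc c τ) (A τ) j‖ +
          ‖normB m γ b (zc c τ) (B τ) j‖)) / ‖X τ‖ := fun x hx => by
      have hre : (zc c τ).re ≤ 0 := by
        rw [zc_re]
        nlinarith [mul_pos hc hτ0]
      have h := norm_gluedWave_mul_exp_le hm hγ hb hre (A τ) (B τ) (x := x) (by rwa [hb0])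
      rw [tailTime_zero hm hb0] at h
      rw [le_div_iff₀ hXpos, ← norm_mul]
      exact h
    set N : ℝ := ∑ j ∈ Finset.Icc 1 m, (‖normA m γ b (zc c τ) (A τ) j‖ +
          ‖normB m γ b (zc c τ) (B τ) j‖) with hN
    have hN0 : 0 ≤ N := Finset.sum_nonneg fun j _ =>
      add_nonneg (norm_nonneg _) (norm_nonneg _)
    have h1 := norm_integral_mul_le hT.le
      (intervalIntegrable_integral_mul ha.le hT.le hux.memLp hwc.measurable hsup)
      (norm_exp_neg_zc_sq_mul_le hc hτ hK0 (σ := σ) (ψ := fun t => ((deriv χ t : ℝ) : ℂ))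
        (fun t ht => by simp [hχd t ht])
        (fun t ht => by rw [Complex.norm_real]; exact hK t ht))
    have h2 := hD _ _ hwc.measurable hsup
    have h3 : ‖E₃ τ‖ ≤ K * Real.exp (-σ * τ) * (N / ‖X τ‖ * D) :=
      h1.trans (mul_le_mul_of_nonneg_left h2 (by positivity))
    rw [norm_mul, norm_mul, Real.norm_of_nonneg hN0, Real.norm_of_nonneg (Real.exp_pos _).le]
    refine (mul_le_mul_of_nonneg_left h3 hXpos.le).trans (le_of_eq ?_)
    field_simp
  -- the transmission factor
  set k : ℝ → ℂ := fun τ => γ 1 * (-(2 * (Real.sqrt (γ m) *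
    ((1 - -(ρ / zc c τ) / (Real.sqrt (γ m) : ℂ)) / 2))) / (a τ 1 * X τ)) /
    (Real.sqrt (γ 1) * (A τ 1 - B τ 1) * X τ) with hk
  have hklim : Tendsto k atTop (𝓝 (γ 1 * (-(2 * (Real.sqrt (γ m) * ((1 / 2 : ℝ) : ℂ))) / p) /
      (Real.sqrt (γ 1) * q))) :=
    ((((hβ.const_mul _).const_mul 2).neg.div hapos hpC).const_mul _).div hR
      (mul_ne_zero hs1 hqC)
  have hk0 : (γ 1 : ℂ) * (-(2 * (Real.sqrt (γ m) * ((1 / 2 : ℝ) : ℂ))) / p) /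
      (Real.sqrt (γ 1) * q) ≠ 0 := by
    have h1 : (γ 1 : ℂ) ≠ 0 := by exact_mod_cast (hγ 1 hm1).ne'
    refine div_ne_zero (mul_ne_zero h1 (div_ne_zero (neg_ne_zero.2 ?_) hpC)) (mul_ne_zero hs1 hqC)
    refine mul_ne_zero two_ne_zero (mul_ne_zero hsm ?_)
    norm_num
  have hlim : -2 * c * travelTime m γ b = -(2 * c * travelTime m γ b) := by ring
  rw [hlim]
  refine tendsto_log_norm_div_of_isBigO (w := fun τ => X τ * X τ)
    (G := fun τ => ∫ t in (0 : ℝ)..T, E τ t * g t) (σ := σ) (μ := μ)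
    (K := 1 * ∫ t in (0 : ℝ)..T, ‖g t‖) hk0 hklim hC ?_ ?_ ?_ ?_ ?_
  · have := mul_le_mul_of_nonneg_right hMt hc.le
    linarith
  · intro τ
    rw [hX, norm_mul, Complex.norm_exp, Complex.re_mul_ofReal, zc_re, ← Real.exp_add]
    congr 1
    ring
  · filter_upwards [hτc] with τ hτ
    have hτ0 : 0 < τ := lt_of_lt_of_le (by positivity) hτ
    simp only [mul_comm (E τ _)]
    refine norm_integral_mul_le hT.le hg fun t ht => ?_
    rw [hE, norm_exp_neg_zc_sq_mul hc hτ, Real.exp_le_one_iff]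
    nlinarith [ht.1]
  · filter_upwards [eventually_gt_atTop τ₀] with τ hτ using hG τ hτ
  -- the remainder
  have hone : (fun τ => (Real.sqrt (γ 1) : ℂ) * (1 - d τ 1 / a τ 1)) =O[atTop]
      fun _ => (1 : ℝ) := ((hr.const_sub 1).const_mul _).isBigO_one ℝ
  have hSO := hS.isBigO_one ℝ
  have hRO := hR.isBigO_one ℝ
  have hRinv := (hR.inv₀ (mul_ne_zero hs1 hqC)).isBigO_one ℝ
  have hzO : (fun τ => zc c τ) =O[atTop] fun τ : ℝ => τ := by
    refine IsBigO.of_bound (2 * c) ?_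
    filter_upwards [eventually_gt_atTop 0] with τ hτ
    rw [Real.norm_of_nonneg hτ.le]
    exact norm_zc_le hc hτ
  have hweak : (fun τ : ℝ => Real.exp (-σ * τ)) =O[atTop] fun τ => τ * Real.exp (-σ * τ) := by
    refine IsBigO.of_bound 1 ?_
    filter_upwards [eventually_ge_atTop 1] with τ hτ
    rw [Real.norm_of_nonneg (Real.exp_pos _).le, Real.norm_of_nonneg
      (mul_nonneg (by linarith) (Real.exp_pos _).le), one_mul]
    exact le_mul_of_one_le_left (Real.exp_pos _).le hτ
  have hT2 := ((hone.mul (isBigO_const_one ℝ (γ 1 : ℂ) atTop)).mul hSO).mul hE₂O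
  have hT3 := hone.mul hE₃O
  -- The factor z here is the source of the extra τ in the remainder.
  have hT1 := ((hzO.mul hone).mul hRO).mul hE₁O
  simp only [one_mul, mul_one] at hT1 hT2 hT3
  have herr := (((hT2.trans hweak).add (hT3.trans hweak)).sub hT1).mul hRinv
  simp only [mul_one] at herr
  refine herr.congr' ?_ EventuallyEq.rfl
  filter_upwards [haev, hRev, hex, eventually_gt_atTop 0] with τ h1 h2 ⟨⟨A', B'⟩, h3⟩ h4
  have hz := zc_ne_zero hc h4
  have hM' := h3.isMatched hγ hz
  have hwr := hM'.wronskian_eq (had τ) hm le_rfl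
  have hwr2 := (had τ).wronskian_eq (hAB τ) hm le_rfl
  simp only at h3 hwr
  rw [h3.first, h3.last, hdm, zero_mul, mul_zero, sub_zero, mul_zero, one_mul] at hwr
  have hB1 : B' 1 * a τ 1 = d τ 1 :=
    sub_eq_zero.1 ((mul_eq_zero.1 hwr).resolve_left hs1)
  have ha1 : a τ 1 ≠ 0 := left_ne_zero_of_mul h1
  have hB1' : B' 1 = d τ 1 / a τ 1 := by rw [← hB1, mul_div_cancel_right₀ _ ha1]
  -- The Wronskian is evaluated in the last layer, where the decaying wave has no B-term.
  have hw : (Real.sqrt (γ 1) : ℂ) * (d τ 1 * A τ 1 - a τ 1 * B τ 1) = -(Real.sqrt (γ m) *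
      ((1 - -(ρ / zc c τ) / (Real.sqrt (γ m) : ℂ)) / 2)) := by
    rw [hwr2, hdm, ham, hBm]
    linear_combination (-(Real.sqrt (γ m) *
      ((1 - -(ρ / zc c τ) / (Real.sqrt (γ m) : ℂ)) / 2))) * hee τ
  have hΘ : ContDiff ℝ ∞ fun t => E τ t * ((χ t : ℝ) : ℂ) := (hEc τ).mul hχc
  have hval := layerWave_of_value_flux hsm (zc c τ) 1 (-(ρ / zc c τ)) (b m)
  have htest := hu.test_gluedWave hm hγ hb hb0 hT.le (hAB τ)
    (by rw [hAm, hBm, hval.1, hval.2]; field_simp; ring) hΘ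
    ⟨s, hsT, fun t ht => by simp [hχs t ht]⟩
  -- Since e^{-z²t} solves the time equation exactly, only the derivative of the cutoff remains.
  have hdΘ : ∀ t, deriv (fun t => E τ t * ((χ t : ℝ) : ℂ)) t +
      (zc c τ) ^ 2 * (E τ t * ((χ t : ℝ) : ℂ)) = E τ t * ((deriv χ t : ℝ) : ℂ) := fun t => by
    have hdE : HasDerivAt (E τ) (E τ t * (-(zc c τ) ^ 2)) t := by
      have := ((Complex.ofRealCLM.hasDerivAt (x := t)).const_mul (-(zc c τ) ^ 2)).cexp
      simpa [hE] using this
    have hdχ : HasDerivAt (fun t => ((χ t : ℝ) : ℂ)) ((deriv χ t : ℝ) : ℂ) t :=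
      (hχ.differentiable (by simp) t).hasDerivAt.ofReal_comp
    rw [(hdE.fun_mul hdχ).deriv]
    ring
  simp only [hdΘ] at htest
  have hsplit : ∀ {F : ℝ → ℂ}, IntervalIntegrable F volume 0 T →
      ∫ t in (0 : ℝ)..T, F t * E τ t = (∫ t in (0 : ℝ)..T, F t * (E τ t * ((χ t : ℝ) : ℂ))) +
        ∫ t in (0 : ℝ)..T, F t * (E τ t * (1 - χ t)) := fun {F} hF => by
    have hcc : Continuous fun t => E τ t * (1 - ((χ t : ℝ) : ℂ)) :=
      (hEc τ).continuous.mul (continuous_const.sub hχc.continuous)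
    rw [← intervalIntegral.integral_add (hF.mul_continuousOn hΘ.continuous.continuousOn)
      (hF.mul_continuousOn hcc.continuousOn)]
    refine intervalIntegral.integral_congr fun t _ => ?_
    ring
  have hI := indicatorFn_eq hm hγ hb0 hb hu0 hg hz h3
  simp only [layerWave, layerFlux, Complex.ofReal_zero, zero_mul, neg_zero, Complex.exp_zero,
    mul_one] at htest
  rw [hB1'] at hI
  have hfin := indicator_sub_main_eq hI (hsplit hu0) (hsplit hg) htest
    (by rw [← hB1', hB1]) hw h1 h2
  simp only [mul_comm (E τ _) (g _)]
  exact hfin.symm
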